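/- **Setting.** A unifilar hidden semi-Markov model consists of a finite set of internal states $g$, a finite alphabet of symbols $x$, for each $g$ a dwell-time law $\phi_g$ on $(0,\infty)$ and emission probabilities $p(x\mid g)$, and a map $\epsilon^+(g,x)$. In the internal state $g$ a symbol $x$ is drawn from $p(\cdot\mid g)$ and, independently, a duration from $\phi_g$; the symbol is emitted for that duration, then the internal state becomes $\epsilon^+(g,x)$, and the procedure repeats. No symbol follows itself: if $p(x\mid g)>0$ then $p(x\mid\epsilon^+(g,x))=0$. Consider a process in continuous time, indexed by $\mathbb R$ and stationary under time shifts, that is generated by such a model. Its hidden state at time $t$ is $\mathcal G_t=(g,x,\tau)$: the internal state, the symbol being emitted, and the time since its onset. The past $\overleftarrow Y_t$ is the list of all past symbols and durations, ending with the present symbol and the time since its onset; the future $\overrightarrow Y_t$ is the list of all future symbols and durations, starting with the present symbol and the time to the next event. Two pasts are equivalent if the conditional laws of the future given them agree; the causal state $\mathcal S_t$ is the equivalence class of $\overleftarrow Y_t$. A unifilar generator of the observed process is a state process $(R_t)_{t\in\mathbb R}$ such that, given the observed past and all states up to time $t$, the law of $\overrightarrow Y_t$ is a function (the same for all $t$)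 of $R_t$, and such that for every $s\ge 0$, $R_{t+s}$ is almost surely a function (the same for all $t$) of $R_t$ and the symbols observed during $[t,t+s]$. The model is minimal if its hidden states $(g,x,\tau)$ are minimal among the states of all unifilar generators of the observed process: whenever $f$ is a measurable function such that $f(\mathcal G_t)$ is the state process of a unifilar generator, $f$ is one-to-one on a measurable set that contains $\mathcal G_t$ almost surely for each $t$. **Theorem.** The hidden states $(g,x,\tau)$ of a minimal unifilar hidden semi-Markov model that generates a stationary process are, up to null sets, the causal states of the process. Precisely, there are a measurable map $h$ from pasts to hidden states, a measurable set $A$ of pasts with $\overleftarrow Y_t\in A$ almost surely for each $t$, and a map $\Psi$ from hidden states to causal states, such that 1. $\mathcal G_t=h(\overleftarrow Y_t)$ almost surely, for each $t$: the past determines the hidden state; 2. $P(\overrightarrow Y_t\mid\overleftarrow Y_t)=P(\overrightarrow Y_t\mid\mathcal G_t)$ almost surely, for each $t$: the hidden state is a sufficient statistic of prediction; 3. two pasts in $A$ are in the same causal state if and only if $h$ takes the same value at them; $\Psi$ is a bijection from $h(A)$ onto the set of causal states of pasts in $A$; it maps $h(\overleftarrow y)$ to the causal state of $\overleftarrow y$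 for each $\overleftarrow y\in A$; and $\Psi(\mathcal G_t)=\mathcal S_t$ almost surely, for each $t$; 4. for every $\overleftarrow y\in A$, the conditional law of the future given $\overleftarrow y$ is the law of the future that the model produces from the hidden state $h(\overleftarrow y)$. -/

import Mathlib

open MeasureTheory ProbabilityTheory Set
open scoped ENNReal

noncomputable section

/-- A unifilar hidden semi-Markov model: internal states `S`, output symbols `X`. In the internal
state `g` a symbol is drawn from `emit g`, a duration is drawn from `dwell g` (a probability law on
`(0, ∞)`), the symbol is emitted for that duration, and then the internal state becomes
`next g x`. A symbol is never followed by itself. -/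
structure UHSMM (S X : Type) where
  emit : S → PMF X
  dwell : S → Measure ℝ
  dwell_prob : ∀ g, IsProbabilityMeasure (dwell g)
  dwell_pos : ∀ g, dwell g (Iic 0) = 0
  next : S → X → S
  emit_ne : ∀ g x, emit g x ≠ 0 → emit (next g x) x = 0

/-- Hidden states `(g, x, τ)`: internal state, symbol being emitted, time since its onset. -/
abbrev HiddenState (S X : Type) := S × X × ℝ

/-- Entry `0` is (present symbol, time since its onset); entry `k ≥ 1` is
(symbol, duration) of the `k`-th event before the present one. -/
abbrev PastList (X : Type) := ℕ → X × ℝ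

/-- Entry `0` is (present symbol, time to the next event); entry `k ≥ 1` is
(symbol, duration) of the `k`-th event after the present one. -/
abbrev FutureList (X : Type) := ℕ → X × ℝ

/-- The lists whose first entries lie in the successive sets of `Bs`. -/
def cylinderOf {E : Type} (Bs : List (Set E)) : Set (ℕ → E) :=
  {F | ∀ (i : ℕ) (h : i < Bs.length), F i ∈ Bs[i]}

namespace UHSMM

variable {S X : Type} [Fintype X]

/-- Probability that the model, when it has just entered the internal state `g`, produces
successive (symbol, duration) pairs in the successive sets of the list. -/
def eventProb (M : UHSMM S X) : S → List (Set (X × ℝ)) → ℝ≥0∞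
  | _, [] => 1
  | g, B :: Bs =>
      ∑ x : X, M.emit g x * M.dwell g {d | (x, d) ∈ B} * M.eventProb (M.next g x) Bs

/-- Probability that the model, in the hidden state `(g, x, τ)`, has a future with entries in the
successive sets of the list: the current duration is conditioned to exceed `τ`, what is left
of it is the time to the next event, and then the model restarts from `next g x`. -/
def futureProb (M : UHSMM S X) (z : HiddenState S X) : List (Set (X × ℝ)) → ℝ≥0∞
  | [] => 1
  | B :: Bs =>
      cond (M.dwell z.1) (Ioi z.2.2) {d | (z.2.1, d - z.2.2) ∈ B}
        * M.eventProb (M.next z.1 z.2.1) Bs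

end UHSMM

/-- A random bi-infinite sequence of events in continuous time: event `n` starts at time
`time n`, has the symbol `sym n` and the internal state `int n`, and ends at `time (n + 1)`. -/
structure EventSeq (S X Ω : Type*) [MeasurableSpace S] [MeasurableSpace X]
    [MeasurableSpace Ω] where
  time : ℤ → Ω → ℝ
  sym : ℤ → Ω → X
  int : ℤ → Ω → S
  measurable_time : ∀ n, Measurable (time n)
  measurable_sym : ∀ n, Measurable (sym n)
  measurable_int : ∀ n, Measurable (int n)
  strictMono_time : ∀ ω, StrictMono fun n => time n ω
  time_unbounded : ∀ ω (c : ℝ), ∃ m n : ℤ, time m ω ≤ c ∧ c < time n ω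

namespace EventSeq

variable {S X : Type} {Ω : Type*} [MeasurableSpace S] [MeasurableSpace X] [MeasurableSpace Ω]

/-- Index of the event in progress at time `t`. -/
def cur (Y : EventSeq S X Ω) (t : ℝ) (ω : Ω) : ℤ := sSup {n : ℤ | Y.time n ω ≤ t}

/-- The symbol observed at time `t`. -/
def symbolAt (Y : EventSeq S X Ω) (t : ℝ) (ω : Ω) : X := Y.sym (Y.cur t ω) ω

/-- The hidden state `(g, x, τ)` at time `t`. -/
def hidden (Y : EventSeq S X Ω) (t : ℝ) (ω : Ω) : HiddenState S X :=
  (Y.int (Y.cur t ω) ω, Y.sym (Y.cur t ω) ω, t - Y.time (Y.cur t ω) ω)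

/-- The observed past at time `t`. -/
def past (Y : EventSeq S X Ω) (t : ℝ) (ω : Ω) : PastList X := fun k =>
  (Y.sym (Y.cur t ω - k) ω,
    if k = 0 then t - Y.time (Y.cur t ω) ω
    else Y.time (Y.cur t ω - k + 1) ω - Y.time (Y.cur t ω - k) ω)

/-- The observed future at time `t`. -/
def future (Y : EventSeq S X Ω) (t : ℝ) (ω : Ω) : FutureList X := fun k =>
  (Y.sym (Y.cur t ω + k) ω,
    if k = 0 then Y.time (Y.cur t ω + 1) ω - t
    else Y.time (Y.cur t ω + k + 1) ω - Y.time (Y.cur t ω + k) ω)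

/-- The past at time `t` together with the internal states of all its events. -/
def fullPast (Y : EventSeq S X Ω) (t : ℝ) (ω : Ω) : ℕ → S × X × ℝ := fun k =>
  (Y.int (Y.cur t ω - k) ω, Y.past t ω k)

/-- The law of past, future and internal states does not depend on the present time. -/
def IsStationary (Y : EventSeq S X Ω) (P : Measure Ω) : Prop :=
  ∀ t : ℝ, P.map (fun ω => (Y.fullPast t ω, Y.future t ω)) =
    P.map (fun ω => (Y.fullPast 0 ω, Y.future 0 ω))

/-- The model `M` generates the events: internal states follow `M.next`, and at each time `t`,
given everything up to `t`, the future is produced by `M` from the current hidden state. -/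
def IsGeneratedBy [Fintype X] (Y : EventSeq S X Ω) (P : Measure Ω) (M : UHSMM S X) : Prop :=
  (∀ n ω, Y.int (n + 1) ω = M.next (Y.int n ω) (Y.sym n ω)) ∧
  ∀ (t : ℝ) (A : Set (ℕ → S × X × ℝ)) (Bs : List (Set (X × ℝ))),
    MeasurableSet A → (∀ B ∈ Bs, MeasurableSet B) →
      P ({ω | Y.fullPast t ω ∈ A} ∩ {ω | Y.future t ω ∈ cylinderOf Bs}) =
        ∫⁻ ω in {ω | Y.fullPast t ω ∈ A}, M.futureProb (Y.hidden t ω) Bs ∂P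

/-- The σ-algebra of the observed past at time `t` and the values up to time `t` of `R`. -/
abbrev history {α : Type} [MeasurableSpace α] (Y : EventSeq S X Ω) (R : ℝ → Ω → α) (t : ℝ) :
    MeasurableSpace Ω :=
  MeasurableSpace.comap (Y.past t) inferInstance ⊔
    ⨆ u : Iic t, MeasurableSpace.comap (R u) inferInstance

/-- `R` is the state of a unifilar generator of the observed symbols and durations.
Generation: given the observed past and the states up to now, the law of the future
is a fixed function of the current state. Unifilarity: the current state and the symbols emitted
over the next `s` units of time determine the state at the end of that period. -/
structure IsUnifilarGenerator {α : Type} [MeasurableSpace α] (Y : EventSeq S X Ω)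
    (P : Measure Ω) (R : ℝ → Ω → α) : Prop where
  measurable : ∀ t, Measurable (R t)
  generates : ∃ κ : Kernel α (FutureList X), ∀ (t : ℝ) (E : Set Ω) (B : Set (FutureList X)),
    MeasurableSet[Y.history R t] E → MeasurableSet B →
      P (E ∩ {ω | Y.future t ω ∈ B}) = ∫⁻ ω in E, κ (R t ω) B ∂P
  unifilar : ∃ upd : (s : ℝ) → α → (Icc (0 : ℝ) s → X) → α,
    ∀ t s : ℝ, 0 ≤ s → ∀ᵐ ω ∂P,
      R (t + s) ω = upd s (R t ω) fun r => Y.symbolAt (t + r) ω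

/-- Minimality of the hidden states among the states of all unifilar generators of the observed
symbols and durations: a unifilar generator whose state is a function of the hidden state
has, up to a null set, as many states, that is, the function identifies no two of them. -/
def HiddenIsMinimal (Y : EventSeq S X Ω) (P : Measure Ω) : Prop :=
  ∀ (α : Type) [MeasurableSpace α] (f : HiddenState S X → α), Measurable f →
    Y.IsUnifilarGenerator P (fun t ω => f (Y.hidden t ω)) →
      ∃ D : Set (HiddenState S X), MeasurableSet D ∧
        (∀ t, ∀ᵐ ω ∂P, Y.hidden t ω ∈ D) ∧ InjOn f D

/-- The conditional law of the future given the past. -/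
def predictive [Countable X] [DiscreteMeasurableSpace X] [Nonempty X]
    (Y : EventSeq S X Ω) (P : Measure Ω) [IsFiniteMeasure P] (y : PastList X) :
    Measure (FutureList X) :=
  condDistrib (Y.future 0) (Y.past 0) P y

/-- Two pasts are equivalent if the conditional laws of the future given them agree. -/
def causalSetoid [Countable X] [DiscreteMeasurableSpace X] [Nonempty X]
    (Y : EventSeq S X Ω) (P : Measure Ω) [IsFiniteMeasure P] : Setoid (PastList X) where
  r y y' := Y.predictive P y = Y.predictive P y'
  iseqv := ⟨fun _ => rfl, fun h => h.symm, fun h h' => h.trans h'⟩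

/-- Causal states are the equivalence classes of pasts. -/
abbrev CausalState [Countable X] [DiscreteMeasurableSpace X] [Nonempty X]
    (Y : EventSeq S X Ω) (P : Measure Ω) [IsFiniteMeasure P] : Type :=
  Quotient (Y.causalSetoid P)

/-- The causal state that contains a given past. -/
def causalState [Countable X] [DiscreteMeasurableSpace X] [Nonempty X]
    (Y : EventSeq S X Ω) (P : Measure Ω) [IsFiniteMeasure P] (y : PastList X) :
    Y.CausalState P :=
  Quotient.mk (Y.causalSetoid P) y

end EventSeq

end

/-! The proof has two halves. The first uses stationarity and unifilarity, but not minimality, to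
show that the past and the hidden state predict alike. Let V(t) be the expected sum, over internal
states, of the squared posterior probability given the past at time t. Stationarity makes V constant
(`sum_integral_sq_condExp_internal`). Yet two effects can only raise it: further observation, by
Pythagoras (`integral_sub_sq_condExp`), and the unifilar update, which merges posterior masses
(`sum_sq_condExp_le_of_update`). Equality must therefore hold in Pythagoras: observation after t
leaves the posterior of the internal state at t unchanged (`condExp_ae_eq_of_update`), and Lévy's
upward theorem extends this to the entire future. So internal state and future are conditionally
independent given the past. Since the law of the future given the past and the internal state is a
function of the hidden state, this law is also the one given the past alone
(`condDistrib_past_eq_futureKernel`).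

The second half uses minimality. The map `futureKernel` from hidden states to laws of the future
yields a unifilar generator (`isUnifilarGenerator_futureKernel`): conditioning the present law on
what is then observed gives the next law, and since no symbol follows itself, the symbols seen
determine the observed events. Minimality makes this map one-to-one off a null set. The past thus
determines the law of the future, which determines the hidden state. Countably many cylinders
identify the law with the formula of the model on one set of hidden states that serves all cylinders
(`exists_measurableSet_futureKernel_cylinderOf`). -/

theorem Measurable.countable_index {ι Ω E : Type*} [Countable ι] [MeasurableSpace ι]
    [DiscreteMeasurableSpace ι] {m : MeasurableSpace Ω} [MeasurableSpace E] {f : ι → Ω → E}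
    {K : Ω → ι} (hf : ∀ i, Measurable (f i)) (hK : Measurable K) :
    Measurable fun ω => f (K ω) ω := by
  have : Measurable fun p : ι × Ω => f p.1 p.2 := measurable_from_prod_countable_right hf
  exact this.comp (hK.prodMk measurable_id)

/-! ### The event in progress, event counts, measurability. -/

namespace EventSeq

variable {S X : Type} {Ω : Type*} [MeasurableSpace S] [MeasurableSpace X]

section Index

variable [MeasurableSpace Ω] (Y : EventSeq S X Ω)

/-- Event times are unbounded in both directions, so the supremum is over a nonempty bounded set of
integers and is attained. -/
theorem le_cur_iff (t : ℝ) (ω : Ω) (n : ℤ) : n ≤ Y.cur t ω ↔ Y.time n ω ≤ t := by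
  have hmono := Y.strictMono_time ω
  obtain ⟨a, b, ha, hb⟩ := Y.time_unbounded ω t
  have hbdd : BddAbove {n : ℤ | Y.time n ω ≤ t} :=
    ⟨b, fun n hn => (hmono.lt_iff_lt.1 (lt_of_le_of_lt hn hb)).le⟩
  have hmem : Y.time (Y.cur t ω) ω ≤ t := Int.csSup_mem ⟨a, ha⟩ hbdd
  exact ⟨fun h => (hmono.monotone h).trans hmem, fun h => le_csSup hbdd h⟩

theorem time_cur_le (t : ℝ) (ω : Ω) : Y.time (Y.cur t ω) ω ≤ t :=
  (Y.le_cur_iff t ω _).1 le_rfl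

theorem cur_lt_iff (t : ℝ) (ω : Ω) (n : ℤ) : Y.cur t ω < n ↔ t < Y.time n ω := by
  rw [← not_le, ← not_le, Y.le_cur_iff]

theorem cur_mono (ω : Ω) : Monotone fun t => Y.cur t ω := fun _ _ h =>
  (Y.le_cur_iff _ _ _).2 ((Y.time_cur_le _ _).trans h)

theorem measurable_cur (t : ℝ) : Measurable (Y.cur t) := by
  refine measurable_of_Ici fun n => ?_
  have : Y.cur t ⁻¹' Ici n = {ω | Y.time n ω ≤ t} := by
    ext ω; exact Y.le_cur_iff t ω n
  rw [this]
  exact measurableSet_le (Y.measurable_time n) measurable_const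

theorem measurable_time_index {K : Ω → ℤ} (hK : Measurable K) :
    Measurable fun ω => Y.time (K ω) ω := Measurable.countable_index Y.measurable_time hK

theorem measurable_sym_index {K : Ω → ℤ} (hK : Measurable K) :
    Measurable fun ω => Y.sym (K ω) ω := Measurable.countable_index Y.measurable_sym hK

theorem measurable_int_index {K : Ω → ℤ} (hK : Measurable K) :
    Measurable fun ω => Y.int (K ω) ω := Measurable.countable_index Y.measurable_int hK

theorem measurable_past (t : ℝ) : Measurable (Y.past t) := by
  have hc := Y.measurable_cur t
  refine measurable_pi_lambda _ fun k => ?_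
  refine (Y.measurable_sym_index (hc.sub_const _)).prodMk ?_
  split_ifs
  · exact measurable_const.sub (Y.measurable_time_index hc)
  · exact (Y.measurable_time_index ((hc.sub_const _).add_const _)).sub
      (Y.measurable_time_index (hc.sub_const _))

theorem measurable_future (t : ℝ) : Measurable (Y.future t) := by
  have hc := Y.measurable_cur t
  refine measurable_pi_lambda _ fun k => ?_
  refine (Y.measurable_sym_index (hc.add_const _)).prodMk ?_
  split_ifs
  · exact (Y.measurable_time_index (hc.add_const _)).sub measurable_const
  · exact (Y.measurable_time_index ((hc.add_const _).add_const _)).sub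
      (Y.measurable_time_index (hc.add_const _))

theorem measurable_fullPast (t : ℝ) : Measurable (Y.fullPast t) :=
  measurable_pi_lambda _ fun _ =>
    (Y.measurable_int_index ((Y.measurable_cur t).sub_const _)).prodMk
      ((measurable_pi_apply _).comp (Y.measurable_past t))

theorem hidden_eq_fullPast (t : ℝ) (ω : Ω) : Y.hidden t ω = Y.fullPast t ω 0 := by
  simp [hidden, fullPast, past]

theorem hidden_eq_past (t : ℝ) (ω : Ω) :
    Y.hidden t ω = (Y.int (Y.cur t ω) ω, Y.past t ω 0) := by
  simp [hidden, past]

theorem measurable_hidden (t : ℝ) : Measurable (Y.hidden t) := by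
  have : Y.hidden t = fun ω => Y.fullPast t ω 0 := funext fun ω => Y.hidden_eq_fullPast t ω
  rw [this]
  exact (measurable_pi_apply 0).comp (Y.measurable_fullPast t)

/-- The number of events that start in `(u, t]`. -/
noncomputable def lag (Y : EventSeq S X Ω) (u t : ℝ) (ω : Ω) : ℕ := (Y.cur t ω - Y.cur u ω).toNat

theorem lag_cast {u t : ℝ} (h : u ≤ t) (ω : Ω) :
    (Y.lag u t ω : ℤ) = Y.cur t ω - Y.cur u ω :=
  Int.toNat_of_nonneg (sub_nonneg.2 (Y.cur_mono ω h))

theorem le_lag_iff {u t : ℝ} (h : u ≤ t) (ω : Ω) (k : ℕ) :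
    k ≤ Y.lag u t ω ↔ k = 0 ∨ Y.time (Y.cur u ω + k) ω ≤ t := by
  have hl := Y.lag_cast h ω
  rw [← Y.le_cur_iff]
  omega

end Index

/-! ### What the past at one time reveals about earlier times. -/

section PastInformation

variable {m m₀ : MeasurableSpace Ω} (Y : EventSeq S X Ω) {t u : ℝ}

theorem measurable_time_cur_sub (hm : Measurable[m] (Y.past t)) (k : ℕ) :
    Measurable[m] fun ω => Y.time (Y.cur t ω - k) ω := by
  induction k with
  | zero =>
    have : (fun ω => Y.time (Y.cur t ω - (0 : ℕ)) ω) = fun ω => t - (Y.past t ω 0).2 := by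
      ext ω; simp [past]
    rw [this]
    exact measurable_const.sub (measurable_snd.comp ((measurable_pi_apply 0).comp hm))
  | succ k ih =>
    have : (fun ω => Y.time (Y.cur t ω - (k + 1 : ℕ)) ω) =
        fun ω => Y.time (Y.cur t ω - k) ω - (Y.past t ω (k + 1)).2 := by
      ext ω
      have : Y.cur t ω - ((k + 1 : ℕ) : ℤ) + 1 = Y.cur t ω - k := by push_cast; ring
      simp only [past, Nat.succ_ne_zero, if_false, this]
      ring
    rw [this]
    exact ih.sub (measurable_snd.comp ((measurable_pi_apply (k + 1)).comp hm))

theorem measurable_sym_cur_sub (hm : Measurable[m] (Y.past t)) (k : ℕ) :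
    Measurable[m] fun ω => Y.sym (Y.cur t ω - k) ω :=
  measurable_fst.comp ((measurable_pi_apply k).comp hm)

theorem measurable_int_cur_sub (hm : Measurable[m] (Y.fullPast t)) (k : ℕ) :
    Measurable[m] fun ω => Y.int (Y.cur t ω - k) ω :=
  measurable_fst.comp ((measurable_pi_apply k).comp hm)

theorem measurable_past_of_fullPast (hm : Measurable[m] (Y.fullPast t)) :
    Measurable[m] (Y.past t) :=
  @measurable_pi_lambda _ _ _ m _ _ fun k => measurable_snd.comp ((measurable_pi_apply k).comp hm)

/-- The count is at most `k` exactly when the event `k` steps before the present one began by time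
`u`, and onsets are visible in the past at `t`. -/
theorem measurable_lag (h : u ≤ t) (hm : Measurable[m] (Y.past t)) :
    Measurable[m] (Y.lag u t) := by
  refine measurable_of_Iic fun k => ?_
  have : Y.lag u t ⁻¹' Iic k = {ω | Y.time (Y.cur t ω - k) ω ≤ u} := by
    ext ω
    have hl := Y.lag_cast h ω
    simp only [mem_preimage, mem_Iic, mem_ofPred_eq, ← Y.le_cur_iff]
    omega
  rw [this]
  exact measurableSet_le (Y.measurable_time_cur_sub hm k) measurable_const

theorem cur_eq_sub_lag (h : u ≤ t) (ω : Ω) : Y.cur u ω = Y.cur t ω - Y.lag u t ω := by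
  rw [Y.lag_cast h]; ring

/-- The earlier past is the later one re-indexed by the number of events in between. With `m`
arbitrary, this makes observed pasts a filtration. -/
theorem measurable_past_of_le (h : u ≤ t) (hm : Measurable[m] (Y.past t)) :
    Measurable[m] (Y.past u) := by
  have hT : ∀ k : ℕ, Measurable[m] fun ω => Y.time (Y.cur u ω - k) ω := fun k => by
    have : (fun ω => Y.time (Y.cur u ω - k) ω) =
        fun ω => Y.time (Y.cur t ω - (Y.lag u t ω + k : ℕ)) ω := by
      ext ω; rw [Y.cur_eq_sub_lag h]; push_cast; congr 1; ring
    rw [this]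
    exact Measurable.countable_index (f := fun (k : ℕ) ω => Y.time (Y.cur t ω - k) ω)
      (Y.measurable_time_cur_sub hm) ((Y.measurable_lag h hm).add_const k)
  refine @measurable_pi_lambda _ _ _ m _ _ fun k => Measurable.prodMk ?_ ?_
  · have : (fun ω => Y.sym (Y.cur u ω - k) ω) =
        fun ω => Y.sym (Y.cur t ω - (Y.lag u t ω + k : ℕ)) ω := by
      ext ω; rw [Y.cur_eq_sub_lag h]; push_cast; congr 1; ring
    rw [this]
    exact Measurable.countable_index (f := fun (k : ℕ) ω => Y.sym (Y.cur t ω - k) ω)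
      (Y.measurable_sym_cur_sub hm) ((Y.measurable_lag h hm).add_const k)
  · rcases k with _ | k
    · simpa [Pi.sub_def] using (measurable_const (a := u)).sub (hT 0)
    · have : ∀ ω, Y.cur u ω - ((k + 1 : ℕ) : ℤ) + 1 = Y.cur u ω - k := fun ω => by
        push_cast; ring
      simpa only [Nat.succ_ne_zero, if_false, this, Pi.sub_def] using (hT k).sub (hT (k + 1))

theorem measurable_fullPast_of_le (h : u ≤ t) (hm : Measurable[m] (Y.fullPast t)) :
    Measurable[m] (Y.fullPast u) := by
  have hp := Y.measurable_past_of_fullPast hm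
  refine @measurable_pi_lambda _ _ _ m _ _ fun k => Measurable.prodMk ?_
    ((measurable_pi_apply k).comp (Y.measurable_past_of_le h hp))
  have : (fun ω => Y.int (Y.cur u ω - k) ω) =
      fun ω => Y.int (Y.cur t ω - (Y.lag u t ω + k : ℕ)) ω := by
    ext ω; rw [Y.cur_eq_sub_lag h]; push_cast; congr 1; ring
  rw [this]
  exact Measurable.countable_index (f := fun (k : ℕ) ω => Y.int (Y.cur t ω - k) ω)
    (Y.measurable_int_cur_sub hm) ((Y.measurable_lag h hp).add_const k)

theorem measurable_hidden_of_fullPast (hm : Measurable[m] (Y.fullPast t)) :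
    Measurable[m] (Y.hidden t) := by
  have : Y.hidden t = fun ω => Y.fullPast t ω 0 := funext fun ω => Y.hidden_eq_fullPast t ω
  rw [this]
  exact (measurable_pi_apply 0).comp hm

end PastInformation

end EventSeq

/-! ### Splitting a future at time `s`: the part seen and the remainder. -/

noncomputable section

namespace FutureList

variable {X : Type}

/-- The time from the present to the onset of the `k`-th event of the future, `0` for the event
in progress. -/
def onset (F : FutureList X) (k : ℕ) : ℝ := ∑ i ∈ Finset.range k, (F i).2

theorem onset_zero (F : FutureList X) : onset F 0 = 0 := by simp [onset]

theorem onset_succ (F : FutureList X) (k : ℕ) : onset F (k + 1) = onset F k + (F k).2 :=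
  Finset.sum_range_succ _ _

/-- The second alternative does not involve `n`; it makes the search terminate on lists that no
event sequence produces. -/
theorem exists_crossings (s : ℝ) (F : FutureList X) :
    ∃ n, s < onset F (n + 1) ∨ ∀ j, onset F (j + 1) ≤ s := by
  by_contra! h
  obtain ⟨j, hj⟩ := (h 0).2
  exact absurd hj (not_lt.2 (h j).1)

open Classical in
/-- The number of events of the future that start up to time `s`, `0` if there are infinitely
many. -/
def crossings (s : ℝ) (F : FutureList X) : ℕ := Nat.find (exists_crossings s F)

/-- What is seen of a future up to time `s`: the number of events that start, their
symbols, and their durations except for the last one. -/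
def observe (s : ℝ) (F : FutureList X) : ℕ × (ℕ → X × ℝ) :=
  (crossings s F, fun k =>
    ((F (min k (crossings s F))).1, if k < crossings s F then (F k).2 else 0))

/-- What remains of a future after time `s`. -/
def shift (s : ℝ) (F : FutureList X) : FutureList X := fun k =>
  ((F (crossings s F + k)).1,
    if k = 0 then onset F (crossings s F + 1) - s else (F (crossings s F + k)).2)

variable [MeasurableSpace X]

theorem measurable_onset (k : ℕ) : Measurable fun F : FutureList X => onset F k :=
  Finset.measurable_fun_sum _ fun i _ => measurable_snd.comp (measurable_pi_apply i)

theorem measurable_crossings (s : ℝ) : Measurable (crossings (X := X) s) := by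
  classical
  refine measurable_find _ fun k => ?_
  refine (measurableSet_lt measurable_const (measurable_onset (k + 1))).union ?_
  exact MeasurableSet.congr (MeasurableSet.iInter fun j =>
    measurableSet_le (measurable_onset (j + 1)) (measurable_const (a := s))) (by ext; simp; rfl)

theorem measurable_apply_index {K : FutureList X → ℕ} (hK : Measurable K) :
    Measurable fun F : FutureList X => F (K F) :=
  Measurable.countable_index (f := fun i (F : FutureList X) => F i) measurable_pi_apply hK

theorem measurable_observe (s : ℝ) : Measurable (observe (X := X) s) := by
  have hN := measurable_crossings (X := X) s
  refine hN.prodMk (measurable_pi_lambda _ fun k => Measurable.prodMk ?_ ?_)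
  · exact measurable_fst.comp (measurable_apply_index (measurable_const.min hN))
  · exact Measurable.ite (measurableSet_lt measurable_const hN)
      (measurable_snd.comp (measurable_pi_apply k)) measurable_const

theorem measurable_shift (s : ℝ) : Measurable (shift (X := X) s) := by
  have hN := measurable_crossings (X := X) s
  refine measurable_pi_lambda _ fun k => Measurable.prodMk ?_ ?_
  · exact measurable_fst.comp (measurable_apply_index (hN.add_const k))
  · split_ifs
    · exact (Measurable.countable_index (f := fun i (F : FutureList X) => onset F i)
        measurable_onset (hN.add_const 1)).sub_const s
    · exact measurable_snd.comp (measurable_apply_index (hN.add_const k))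

end FutureList

namespace UHSMM

variable {S X : Type}

/-- The internal state after the first `n` symbols of `w`. -/
def run (M : UHSMM S X) (g : S) (w : ℕ → X) : ℕ → S
  | 0 => g
  | n + 1 => M.next (M.run g w n) (w n)

theorem run_congr (M : UHSMM S X) (g : S) {w w' : ℕ → X} {n : ℕ} (h : ∀ i < n, w i = w' i) :
    M.run g w n = M.run g w' n := by
  induction n with
  | zero => rfl
  | succ n ih =>
    rw [run, run, ih fun i hi => h i (by omega), h n (by omega)]

/-- The hidden state after time `s`, if `b` is observed until then. -/
def advance (M : UHSMM S X) (s : ℝ) (z : HiddenState S X) (b : ℕ × (ℕ → X × ℝ)) :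
    HiddenState S X :=
  (M.run z.1 (fun k => (b.2 k).1) b.1, (b.2 b.1).1,
    if b.1 = 0 then z.2.2 + s else s - ∑ i ∈ Finset.range b.1, (b.2 i).2)

theorem measurable_run [Countable S] [Countable X] [MeasurableSpace S]
    [DiscreteMeasurableSpace S] [MeasurableSpace X] [DiscreteMeasurableSpace X]
    (M : UHSMM S X) (n : ℕ) :
    Measurable fun p : S × (ℕ → X) => M.run p.1 p.2 n := by
  induction n with
  | zero => exact measurable_fst
  | succ n ih =>
    have : Measurable fun p : S × X => M.next p.1 p.2 := Measurable.of_discrete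
    exact this.comp (ih.prodMk ((measurable_pi_apply n).comp measurable_snd))

theorem measurable_advance [Countable S] [Countable X] [MeasurableSpace S]
    [DiscreteMeasurableSpace S] [MeasurableSpace X] [DiscreteMeasurableSpace X]
    (M : UHSMM S X) (s : ℝ) :
    Measurable fun p : HiddenState S X × (ℕ × (ℕ → X × ℝ)) => M.advance s p.1 p.2 := by
  have hN : Measurable fun p : HiddenState S X × (ℕ × (ℕ → X × ℝ)) => p.2.1 := by fun_prop
  have hw : ∀ k, Measurable fun p : HiddenState S X × (ℕ × (ℕ → X × ℝ)) => p.2.2 k := by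
    fun_prop
  refine Measurable.prodMk ?_ (Measurable.prodMk ?_ ?_)
  · have : Measurable fun p : HiddenState S X × (ℕ × (ℕ → X × ℝ)) =>
        ((p.1.1, fun k => (p.2.2 k).1) : S × (ℕ → X)) := by fun_prop
    exact Measurable.countable_index
      (f := fun n (p : HiddenState S X × (ℕ × (ℕ → X × ℝ))) =>
        M.run p.1.1 (fun k => (p.2.2 k).1) n) (fun n => (M.measurable_run n).comp this) hN
  · exact measurable_fst.comp (Measurable.countable_index hw hN)
  · refine Measurable.ite (hN (measurableSet_singleton 0)) (by fun_prop) ?_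
    refine measurable_const.sub (Measurable.countable_index
      (f := fun n (p : HiddenState S X × (ℕ × (ℕ → X × ℝ))) =>
        ∑ i ∈ Finset.range n, (p.2.2 i).2) (fun n => by fun_prop) hN)

end UHSMM

namespace EventSeq

open FutureList

variable {S X : Type} {Ω : Type*} [MeasurableSpace S] [MeasurableSpace X]

/-! ### Deterministic evolution of future and hidden state. -/

section Dynamics

variable [MeasurableSpace Ω] (Y : EventSeq S X Ω) {s t : ℝ} {ω : Ω}

theorem onset_future_succ (t : ℝ) (ω : Ω) (k : ℕ) :
    onset (Y.future t ω) (k + 1) = Y.time (Y.cur t ω + k + 1) ω - t := by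
  induction k with
  | zero => simp [onset, future]
  | succ k ih =>
    rw [onset_succ, ih]
    simp only [future, Nat.succ_ne_zero, if_false]
    push_cast
    rw [← add_assoc]
    ring

theorem onset_future_lt (t : ℝ) (ω : Ω) (k : ℕ) :
    onset (Y.future t ω) k < onset (Y.future t ω) (k + 1) := by
  rw [onset_succ, lt_add_iff_pos_right]
  rcases k with _ | k
  · have := (Y.cur_lt_iff t ω (Y.cur t ω + 1)).1 (by omega)
    simpa [future] using this
  · simpa [future] using Y.strictMono_time ω (lt_add_one _)

theorem onset_future_nonneg (t : ℝ) (ω : Ω) (k : ℕ) : 0 ≤ onset (Y.future t ω) k := by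
  have := (strictMono_nat_of_lt_succ (Y.onset_future_lt t ω)).monotone (Nat.zero_le k)
  rwa [onset_zero] at this

theorem le_lag_iff_onset (hs : 0 ≤ s) (k : ℕ) :
    k ≤ Y.lag t (t + s) ω ↔ onset (Y.future t ω) k ≤ s := by
  rw [Y.le_lag_iff (by linarith)]
  rcases k with _ | k
  · simpa [onset_zero] using hs
  · rw [Y.onset_future_succ]
    push_cast
    rw [← add_assoc, sub_le_iff_le_add, add_comm s]
    simp

/-- Onsets of a genuine future pass every bound, so the search stops for the intended reason. -/
theorem crossings_future (hs : 0 ≤ s) : crossings s (Y.future t ω) = Y.lag t (t + s) ω := by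
  classical
  rw [crossings, Nat.find_eq_iff]
  have h1 : s < onset (Y.future t ω) (Y.lag t (t + s) ω + 1) := by
    rw [← not_le, ← Y.le_lag_iff_onset hs]; omega
  refine ⟨Or.inl h1, fun n hn => ?_⟩
  rintro (h | h)
  · rw [← not_le, ← Y.le_lag_iff_onset hs] at h; omega
  · exact absurd h1 (not_lt.2 (h _))

theorem cur_add (hs : 0 ≤ s) : Y.cur (t + s) ω = Y.cur t ω + Y.lag t (t + s) ω := by
  rw [Y.lag_cast (by linarith)]; ring

theorem shift_future (hs : 0 ≤ s) : Y.future (t + s) ω = shift s (Y.future t ω) := by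
  funext k
  simp only [shift, Y.crossings_future hs, Y.onset_future_succ]
  rcases k with _ | k
  · simp only [future, Y.cur_add hs]
    simp
    ring
  · simp only [future, Y.cur_add hs]
    push_cast
    simp [← add_assoc]

theorem int_cur_add {M : UHSMM S X}
    (hM : ∀ n ω, Y.int (n + 1) ω = M.next (Y.int n ω) (Y.sym n ω)) (t : ℝ) (ω : Ω) (k : ℕ) :
    Y.int (Y.cur t ω + k) ω = M.run (Y.int (Y.cur t ω) ω) (fun i => (Y.future t ω i).1) k := by
  induction k with
  | zero => simp [UHSMM.run]
  | succ k ih =>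
    rw [UHSMM.run, ← ih]
    push_cast
    rw [← add_assoc, hM]
    rfl

/-- This is unifilarity: completed symbols drive the internal state, and the new age is counted from
the last onset, or from the old age if no event has started. -/
theorem hidden_add {M : UHSMM S X}
    (hM : ∀ n ω, Y.int (n + 1) ω = M.next (Y.int n ω) (Y.sym n ω)) (hs : 0 ≤ s) :
    Y.hidden (t + s) ω = M.advance s (Y.hidden t ω) (observe s (Y.future t ω)) := by
  simp only [hidden, UHSMM.advance, observe, Y.crossings_future hs, Y.cur_add hs]
  refine Prod.ext ?_ (Prod.ext ?_ ?_)
  · rw [Y.int_cur_add hM]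
    exact M.run_congr _ fun i hi => by simp [min_eq_left hi.le]
  · simp [future]
  · have hsum : ∑ i ∈ Finset.range (Y.lag t (t + s) ω),
        (if i < Y.lag t (t + s) ω then (Y.future t ω i).2 else 0) =
        onset (Y.future t ω) (Y.lag t (t + s) ω) :=
      Finset.sum_congr rfl fun i hi => by rw [if_pos (Finset.mem_range.1 hi)]
    simp only [hsum]
    rcases h : Y.lag t (t + s) ω with _ | k
    · simp; ring
    · rw [Y.onset_future_succ]
      push_cast
      rw [← add_assoc]
      ring

theorem symbolAt_add (hs : 0 ≤ s) {k : ℕ} (h : onset (Y.future t ω) k ≤ s)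
    (h' : s < onset (Y.future t ω) (k + 1)) :
    Y.symbolAt (t + s) ω = (Y.future t ω k).1 := by
  have : Y.lag t (t + s) ω = k := by
    rw [← Y.le_lag_iff_onset hs] at h
    rw [← not_le, ← Y.le_lag_iff_onset hs] at h'
    omega
  rw [symbolAt, Y.cur_add hs, this]
  rfl

end Dynamics

/-! ### Symbols seen over a period determine its events. -/

section SymbolPath

variable [MeasurableSpace Ω] (Y : EventSeq S X Ω) {s t t' : ℝ} {ω ω' : Ω}

/-- Induction over events. If the next onsets differed, then at the earlier one a path would show a
new symbol while the other still showed the common old one, which no repetition allows. -/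
theorem agree_of_symbolAt_eq (hs : 0 ≤ s) (hω : ∀ n, Y.sym (n + 1) ω ≠ Y.sym n ω)
    (hω' : ∀ n, Y.sym (n + 1) ω' ≠ Y.sym n ω')
    (h : ∀ r ∈ Icc 0 s, Y.symbolAt (t + r) ω = Y.symbolAt (t' + r) ω') {k : ℕ}
    (hk : k ≤ Y.lag t (t + s) ω) :
    k ≤ Y.lag t' (t' + s) ω' ∧ onset (Y.future t ω) k = onset (Y.future t' ω') k ∧
      (Y.future t ω k).1 = (Y.future t' ω' k).1 := by
  have hne : ∀ {t ω}, (∀ n, Y.sym (n + 1) ω ≠ Y.sym n ω) → ∀ k : ℕ,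
      (Y.future t ω (k + 1)).1 ≠ (Y.future t ω k).1 := fun {t ω} hω k => by
    have := hω (Y.cur t ω + k)
    simp only [future]
    push_cast
    rwa [← add_assoc]
  induction k with
  | zero =>
    refine ⟨Nat.zero_le _, by simp [onset_zero], ?_⟩
    simpa [symbolAt, future] using h 0 ⟨le_rfl, hs⟩
  | succ k ih =>
    obtain ⟨-, hon, hsym⟩ := ih (by omega)
    have hle := (Y.le_lag_iff_onset hs (k + 1)).1 hk
    have p0 := Y.onset_future_nonneg t ω (k + 1)
    have p0' := Y.onset_future_nonneg t' ω' (k + 1)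
    have p1 := Y.onset_future_lt t ω k
    have p2 := Y.onset_future_lt t ω (k + 1)
    have p1' := Y.onset_future_lt t' ω' k
    have p2' := Y.onset_future_lt t' ω' (k + 1)
    have heq : onset (Y.future t ω) (k + 1) = onset (Y.future t' ω') (k + 1) := by
      rcases lt_trichotomy (onset (Y.future t ω) (k + 1)) (onset (Y.future t' ω') (k + 1))
        with hlt | heq | hlt
      · have := h _ ⟨p0, hle⟩
        rw [Y.symbolAt_add p0 le_rfl p2, Y.symbolAt_add (k := k) p0 (by linarith) hlt, ← hsym]
          at this
        exact absurd this (hne hω k)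
      · exact heq
      · have := h _ ⟨p0', by linarith⟩
        rw [Y.symbolAt_add p0' le_rfl p2', Y.symbolAt_add (k := k) p0' (by linarith) hlt, hsym]
          at this
        exact absurd this.symm (hne hω' k)
    refine ⟨(Y.le_lag_iff_onset hs (k + 1)).2 (heq ▸ hle), heq, ?_⟩
    have := h _ ⟨p0, hle⟩
    rwa [Y.symbolAt_add p0 le_rfl p2, Y.symbolAt_add (k := k + 1) p0 heq.ge (heq ▸ p2')] at this

/-- If no symbol follows itself, then the symbols seen over a period of time determine the
events that start in it. -/
theorem observe_eq_of_symbolAt_eq (hs : 0 ≤ s) (hω : ∀ n, Y.sym (n + 1) ω ≠ Y.sym n ω)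
    (hω' : ∀ n, Y.sym (n + 1) ω' ≠ Y.sym n ω')
    (h : ∀ r ∈ Icc 0 s, Y.symbolAt (t + r) ω = Y.symbolAt (t' + r) ω') :
    observe s (Y.future t ω) = observe s (Y.future t' ω') := by
  have ha := fun k => Y.agree_of_symbolAt_eq hs hω hω' h (k := k)
  have hlag : Y.lag t (t + s) ω = Y.lag t' (t' + s) ω' :=
    le_antisymm (ha _ le_rfl).1
      (Y.agree_of_symbolAt_eq hs hω' hω (fun r hr => (h r hr).symm) le_rfl).1
  simp only [observe, Y.crossings_future hs, ← hlag]
  refine Prod.ext rfl (funext fun k => Prod.ext (ha _ (min_le_right _ _)).2.2 ?_)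
  show ite _ _ _ = ite _ _ _
  split_ifs with hk
  · have h1 := (ha k hk.le).2.1
    have h2 := (ha (k + 1) hk).2.1
    rw [onset_succ, onset_succ, h1] at h2
    exact add_left_cancel h2
  · rfl

end SymbolPath

/-! ### Observations as functions of later pasts. -/

section ObservedInformation

variable {m m₀ : MeasurableSpace Ω} (Y : EventSeq S X Ω) {s t : ℝ}

/-- Events after `t` are found by counting back from `t + s`. Entry `0` of the future is measured
from `t` and not from an onset, hence the case `k = 0`. -/
theorem measurable_observe_future (hs : 0 ≤ s) (hm : Measurable[m] (Y.past (t + s))) :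
    Measurable[m] fun ω => observe s (Y.future t ω) := by
  have hL := Y.measurable_lag (u := t) (by linarith : t ≤ t + s) hm
  have hT : ∀ φ : ℕ → ℕ, Measurable[m] fun ω =>
      Y.time (Y.cur (t + s) ω - (φ (Y.lag t (t + s) ω) : ℕ)) ω := fun φ =>
    Measurable.countable_index (f := fun (k : ℕ) ω => Y.time (Y.cur (t + s) ω - k) ω)
      (Y.measurable_time_cur_sub hm) ((Measurable.of_discrete (f := φ)).comp hL)
  simp only [observe, Y.crossings_future hs]
  refine hL.prodMk (@measurable_pi_lambda _ _ _ m _ _ fun k => Measurable.prodMk ?_ ?_)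
  · have : (fun ω => (Y.future t ω (min k (Y.lag t (t + s) ω))).1) = fun ω =>
        Y.sym (Y.cur (t + s) ω - (Y.lag t (t + s) ω - k : ℕ)) ω := by
      ext ω
      simp only [future, Y.cur_add hs]
      congr 1
      omega
    rw [this]
    exact Measurable.countable_index (f := fun (k : ℕ) ω => Y.sym (Y.cur (t + s) ω - k) ω)
      (Y.measurable_sym_cur_sub hm)
      ((Measurable.of_discrete (f := fun l : ℕ => l - k)).comp hL)
  · have hset : MeasurableSet[m] {ω | k < Y.lag t (t + s) ω} :=
      hL (measurableSet_Ioi (a := k))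
    have : (fun ω => if k < Y.lag t (t + s) ω then (Y.future t ω k).2 else 0) = fun ω =>
        if k < Y.lag t (t + s) ω then
          Y.time (Y.cur (t + s) ω - (Y.lag t (t + s) ω - (k + 1) : ℕ)) ω -
            (if k = 0 then t else
              Y.time (Y.cur (t + s) ω - (Y.lag t (t + s) ω - k : ℕ)) ω) else 0 := by
      ext ω
      by_cases hk : k < Y.lag t (t + s) ω
      · have h1 : Y.cur (t + s) ω - (Y.lag t (t + s) ω - (k + 1) : ℕ) = Y.cur t ω + k + 1 := by
          rw [Y.cur_add hs]; omega
        have h2 : Y.cur (t + s) ω - (Y.lag t (t + s) ω - k : ℕ) = Y.cur t ω + k := by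
          rw [Y.cur_add hs]; omega
        rw [if_pos hk, if_pos hk, h1, h2]
        by_cases h0 : k = 0
        · simp [future, h0]
        · simp [future, h0]
      · rw [if_neg hk, if_neg hk]
    rw [this]
    refine Measurable.ite hset ((hT fun l => l - (k + 1)).sub ?_) measurable_const
    split_ifs
    · exact measurable_const
    · exact hT fun l => l - k

/-- Entry `k` is read off at the first integer horizon by which event `k` has ended. -/
theorem measurable_future_of_observe
    (hm : ∀ n : ℕ, Measurable[m] fun ω => observe n (Y.future t ω)) :
    Measurable[m] (Y.future t) := by
  classical
  refine @measurable_pi_lambda _ _ _ m _ _ fun k => ?_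
  have hex : ∀ ω, ∃ n : ℕ, k < (observe n (Y.future t ω)).1 := fun ω => by
    obtain ⟨n, hn⟩ := exists_nat_ge (onset (Y.future t ω) (k + 1))
    have := (Y.le_lag_iff_onset n.cast_nonneg (k + 1)).2 hn
    exact ⟨n, by simpa [observe, Y.crossings_future (Nat.cast_nonneg n)] using this⟩
  have hfind : Measurable[m] fun ω => Nat.find (hex ω) :=
    measurable_find _ fun n => (measurable_fst.comp (hm n)) (measurableSet_Ioi (a := k))
  have : (fun ω => Y.future t ω k) =
      fun ω => (observe (Nat.find (hex ω) : ℕ) (Y.future t ω)).2 k := by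
    ext1 ω
    have h : k < (observe (Nat.find (hex ω) : ℕ) (Y.future t ω)).1 := Nat.find_spec (hex ω)
    generalize Nat.find (hex ω) = n at h
    have h' : k < crossings n (Y.future t ω) := h
    simp only [observe]
    rw [if_pos h', min_eq_left h'.le]
  rw [this]
  exact Measurable.countable_index (f := fun (n : ℕ) ω => (observe n (Y.future t ω)).2 k)
    (fun n => (measurable_pi_apply k).comp (measurable_snd.comp (hm n))) hfind

end ObservedInformation

end EventSeq

end

noncomputable section

/-! ### Cylinders generate the σ-algebra of lists. -/

section Cylinders

variable {E : Type}

theorem mem_cylinderOf_iff {Bs : List (Set E)} {F : ℕ → E} :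
    F ∈ cylinderOf Bs ↔ ∀ i, F i ∈ Bs.getD i univ := by
  refine ⟨fun h i => ?_, fun h i hi => ?_⟩
  · by_cases hi : i < Bs.length
    · rw [List.getD_eq_getElem _ _ hi]; exact h i hi
    · rw [List.getD_eq_default _ _ (not_lt.1 hi)]; trivial
  · have := h i
    rwa [List.getD_eq_getElem _ _ hi] at this

theorem mem_cylinderOf_cons {B : Set E} {Bs : List (Set E)} {F : ℕ → E} :
    F ∈ cylinderOf (B :: Bs) ↔ F 0 ∈ B ∧ (fun i => F (i + 1)) ∈ cylinderOf Bs := by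
  simp only [mem_cylinderOf_iff]
  refine ⟨fun h => ⟨h 0, fun i => h (i + 1)⟩, fun h i => ?_⟩
  rcases i with _ | i
  · exact h.1
  · exact h.2 i

theorem cylinderOf_nil : cylinderOf ([] : List (Set E)) = univ := by
  ext F; simp [mem_cylinderOf_iff]

theorem mem_cylinderOf_append {Bs Cs : List (Set E)} {F : ℕ → E} :
    F ∈ cylinderOf (Bs ++ Cs) ↔
      F ∈ cylinderOf Bs ∧ (fun i => F (i + Bs.length)) ∈ cylinderOf Cs := by
  induction Bs generalizing F with
  | nil => simp [cylinderOf_nil]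
  | cons B Bs ih =>
    rw [List.cons_append, mem_cylinderOf_cons, mem_cylinderOf_cons, ih, and_assoc]
    simp only [List.length_cons, add_assoc]

theorem cylinderOf_replicate_univ_append (n : ℕ) (B : Set E) :
    cylinderOf (List.replicate n univ ++ [B]) = (fun F : ℕ → E => F n) ⁻¹' B := by
  ext F
  rw [mem_cylinderOf_append, mem_cylinderOf_cons, cylinderOf_nil]
  have : F ∈ cylinderOf (List.replicate n univ) := fun i hi => by simp
  simp [this]

theorem cylinderOf_inter (Bs Cs : List (Set E)) :
    cylinderOf ((List.range (max Bs.length Cs.length)).map fun i =>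
      Bs.getD i univ ∩ Cs.getD i univ) = cylinderOf Bs ∩ cylinderOf Cs := by
  ext F
  simp only [mem_inter_iff, mem_cylinderOf_iff, ← forall_and]
  refine forall_congr' fun i => ?_
  by_cases hi : i < max Bs.length Cs.length
  · simp [hi]
  · have h1 : Bs.length ≤ i := (le_max_left _ _).trans (not_lt.1 hi)
    have h2 : Cs.length ≤ i := (le_max_right _ _).trans (not_lt.1 hi)
    rw [List.getD_eq_default _ _ h1, List.getD_eq_default _ _ h2,
      List.getD_eq_default _ _ (by simpa using ⟨h1, h2⟩)]
    simp

variable [MeasurableSpace E]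

theorem measurableSet_cylinderOf {Bs : List (Set E)} (h : ∀ B ∈ Bs, MeasurableSet B) :
    MeasurableSet (cylinderOf Bs) := by
  have : cylinderOf Bs = ⋂ i, (fun F : ℕ → E => F i) ⁻¹' Bs.getD i univ := by
    ext F; simp only [mem_cylinderOf_iff, mem_iInter, mem_preimage]
  rw [this]
  refine MeasurableSet.iInter fun i => measurable_pi_apply i ?_
  by_cases hi : i < Bs.length
  · rw [List.getD_eq_getElem _ _ hi]; exact h _ (List.getElem_mem hi)
  · rw [List.getD_eq_default _ _ (not_lt.1 hi)]; exact MeasurableSet.univ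

variable (E) in
/-- The cylinders with measurable sides. -/
def measurableCylindersOf : Set (Set (ℕ → E)) :=
  cylinderOf '' {Bs : List (Set E) | ∀ B ∈ Bs, MeasurableSet B}

theorem isPiSystem_measurableCylindersOf : IsPiSystem (measurableCylindersOf E) := by
  rintro _ ⟨Bs, hBs, rfl⟩ _ ⟨Cs, hCs, rfl⟩ -
  refine ⟨_, fun B hB => ?_, cylinderOf_inter Bs Cs⟩
  obtain ⟨i, -, rfl⟩ := List.mem_map.1 hB
  have hget : ∀ Ds : List (Set E), (∀ B ∈ Ds, MeasurableSet B) → MeasurableSet (Ds.getD i univ) :=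
    fun Ds hDs => by
      by_cases hi : i < Ds.length
      · rw [List.getD_eq_getElem _ _ hi]; exact hDs _ (List.getElem_mem hi)
      · rw [List.getD_eq_default _ _ (not_lt.1 hi)]; exact MeasurableSet.univ
  exact (hget Bs hBs).inter (hget Cs hCs)

theorem generateFrom_measurableCylindersOf :
    MeasurableSpace.generateFrom (measurableCylindersOf E) = MeasurableSpace.pi := by
  refine le_antisymm (MeasurableSpace.generateFrom_le ?_) ?_
  · rintro _ ⟨Bs, hBs, rfl⟩
    exact measurableSet_cylinderOf hBs
  · refine iSup_le fun n => ?_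
    rintro _ ⟨B, hB, rfl⟩
    refine MeasurableSpace.measurableSet_generateFrom
      ⟨_, ?_, cylinderOf_replicate_univ_append n B⟩
    intro C hC
    rcases List.mem_append.1 hC with h | h
    · rw [List.eq_of_mem_replicate h]; exact MeasurableSet.univ
    · rwa [List.mem_singleton.1 h]

end Cylinders

/-! ### The formula of the model as a function of the sides of a cylinder. -/

namespace UHSMM

variable {S X : Type} [Fintype X] [MeasurableSpace X]

theorem measurable_futureProb [Countable S] [MeasurableSpace S] [DiscreteMeasurableSpace S]
    [DiscreteMeasurableSpace X] (M : UHSMM S X) {Bs : List (Set (X × ℝ))}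
    (hBs : ∀ B ∈ Bs, MeasurableSet B) : Measurable fun z => M.futureProb z Bs := by
  rcases Bs with _ | ⟨B, Bs⟩
  · exact measurable_const
  · have hB : MeasurableSet B := hBs B (by simp)
    refine measurable_from_prod_countable_right fun g => measurable_from_prod_countable_right
      fun x => ?_
    simp only [futureProb]
    refine Measurable.mul_const ?_ _
    have := M.dwell_prob g
    simp only [cond_apply measurableSet_Ioi]
    refine Measurable.mul ?_ ?_
    · have : Measurable fun τ : ℝ => M.dwell g (Prod.mk τ ⁻¹' {p : ℝ × ℝ | p.1 < p.2}) :=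
        measurable_measure_prodMk_left (measurableSet_lt measurable_fst measurable_snd)
      exact this.inv
    · have : Measurable fun τ : ℝ => M.dwell g (Prod.mk τ ⁻¹'
          ({p : ℝ × ℝ | p.1 < p.2} ∩ (fun p => (x, p.2 - p.1)) ⁻¹' B)) :=
        measurable_measure_prodMk_left
          ((measurableSet_lt measurable_fst measurable_snd).inter
            ((measurable_const.prodMk (measurable_snd.sub measurable_fst)) hB))
      exact this

/-- With all other sides fixed, the product formula is countably additive in one side. This permits
uniqueness of measures one coordinate at a time, without building the law on infinite lists. -/
theorem exists_measure_eventProb [DiscreteMeasurableSpace X] (M : UHSMM S X) (g : S)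
    (Bs Cs : List (Set (X × ℝ))) :
    ∃ ν : Measure (X × ℝ), ∀ B, MeasurableSet B → ν B = M.eventProb g (Bs ++ B :: Cs) := by
  induction Bs generalizing g with
  | nil =>
    refine ⟨∑ x : X, (M.emit g x * M.eventProb (M.next g x) Cs) •
      (M.dwell g).map (Prod.mk x), fun B hB => ?_⟩
    simp only [List.nil_append, eventProb, Measure.finsetSum_apply, Measure.smul_apply,
      smul_eq_mul, Measure.map_apply measurable_prodMk_left hB]
    refine Finset.sum_congr rfl fun x _ => ?_
    rw [mul_right_comm]
    rfl
  | cons A Bs ih =>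
    choose ν hν using ih
    refine ⟨∑ x : X, (M.emit g x * M.dwell g {d | (x, d) ∈ A}) • ν (M.next g x),
      fun B hB => ?_⟩
    simp only [List.cons_append, eventProb, Measure.finsetSum_apply, Measure.smul_apply,
      smul_eq_mul, hν _ B hB]

theorem exists_measure_futureProb [DiscreteMeasurableSpace X] (M : UHSMM S X)
    (z : HiddenState S X) (Bs Cs : List (Set (X × ℝ))) :
    ∃ ν : Measure (X × ℝ), ∀ B, MeasurableSet B → ν B = M.futureProb z (Bs ++ B :: Cs) := by
  rcases Bs with _ | ⟨A, Bs⟩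
  · refine ⟨M.eventProb (M.next z.1 z.2.1) Cs •
      (cond (M.dwell z.1) (Ioi z.2.2)).map (fun d => (z.2.1, d - z.2.2)), fun B hB => ?_⟩
    rw [Measure.smul_apply, Measure.map_apply (by fun_prop) hB, smul_eq_mul, mul_comm]
    rfl
  · obtain ⟨ν, hν⟩ := M.exists_measure_eventProb (M.next z.1 z.2.1) Bs Cs
    refine ⟨cond (M.dwell z.1) (Ioi z.2.2) {d | (z.2.1, d - z.2.2) ∈ A} • ν, fun B hB => ?_⟩
    rw [Measure.smul_apply, hν B hB]
    rfl

/-- A law of the future that agrees with the model on cylinders with sides in a generating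
set algebra agrees with it on all measurable cylinders. -/
theorem cylinderOf_eq_futureProb [DiscreteMeasurableSpace X] (M : UHSMM S X)
    (z : HiddenState S X) (μ : Measure (FutureList X)) [IsFiniteMeasure μ]
    {𝒜 : Set (Set (X × ℝ))} (h𝒜 : IsSetAlgebra 𝒜)
    (hgen : MeasurableSpace.generateFrom 𝒜 = (inferInstance : MeasurableSpace (X × ℝ)))
    (hμ : ∀ Bs : List (Set (X × ℝ)), (∀ B ∈ Bs, B ∈ 𝒜) →
      μ (cylinderOf Bs) = M.futureProb z Bs)
    (Bs : List (Set (X × ℝ))) (hBs : ∀ B ∈ Bs, MeasurableSet B) :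
    μ (cylinderOf Bs) = M.futureProb z Bs := by
  have hmeas : ∀ B ∈ 𝒜, MeasurableSet B := fun B hB => by
    have := MeasurableSpace.measurableSet_generateFrom hB
    rwa [hgen] at this
  -- The sides are upgraded one by one: those in `Bs` are already arbitrary measurable sets, those
  -- in `Cs` still lie in the algebra.
  suffices h : ∀ Cs : List (Set (X × ℝ)), (∀ C ∈ Cs, C ∈ 𝒜) →
      μ (cylinderOf (Bs ++ Cs)) = M.futureProb z (Bs ++ Cs) by
    simpa using h [] (by simp)
  induction Bs using List.reverseRecOn with
  | nil => simpa using hμ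
  | append_singleton Bs B ih =>
    intro Cs hCs
    have ih := ih fun C hC => hBs C (by simp [hC])
    have hBs' : ∀ C ∈ Bs, MeasurableSet C := fun C hC => hBs C (by simp [hC])
    obtain ⟨ν, hν⟩ := M.exists_measure_futureProb z Bs Cs
    let ν' : Measure (X × ℝ) :=
      (μ.restrict (cylinderOf (Bs ++ univ :: Cs))).map fun F => F Bs.length
    have hν' : ∀ C, MeasurableSet C → ν' C = μ (cylinderOf (Bs ++ C :: Cs)) := fun C hC => by
      have hev : Measurable fun F : FutureList X => F Bs.length := measurable_pi_apply _
      rw [Measure.map_apply hev hC, Measure.restrict_apply (hev hC)]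
      congr 1
      ext F
      simp only [mem_inter_iff, mem_preimage, mem_cylinderOf_append, mem_cylinderOf_cons,
        mem_univ, true_and, zero_add]
      tauto
    have heq : ν' = ν := by
      refine ext_of_generate_finite 𝒜 hgen.symm (fun s hs t ht _ => h𝒜.inter_mem hs ht)
        (fun C hC => ?_) ?_
      · rw [hν' C (hmeas C hC), hν C (hmeas C hC)]
        exact ih _ (by simpa [hC] using hCs)
      · rw [hν' _ .univ, hν _ .univ]
        exact ih _ (by simpa [h𝒜.univ_mem] using hCs)
    have hB : MeasurableSet B := hBs B (by simp)
    rw [List.append_assoc, List.singleton_append, ← hν' B hB, heq, hν B hB]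

end UHSMM

end

/-! ### Consequences of stationarity and generation. -/

noncomputable section

namespace EventSeq

variable {S X : Type} {Ω : Type*} [MeasurableSpace S] [MeasurableSpace X] [MeasurableSpace Ω]

theorem IsStationary.map_eq {Y : EventSeq S X Ω} {P : Measure Ω} (h : Y.IsStationary P) (t : ℝ)
    {E : Type*} [MeasurableSpace E] {φ : (ℕ → S × X × ℝ) × FutureList X → E}
    (hφ : Measurable φ) :
    P.map (fun ω => φ (Y.fullPast t ω, Y.future t ω)) =
      P.map (fun ω => φ (Y.fullPast 0 ω, Y.future 0 ω)) := by
  have hm : ∀ t, Measurable fun ω => (Y.fullPast t ω, Y.future t ω) := fun t =>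
    (Y.measurable_fullPast t).prodMk (Y.measurable_future t)
  have := congrArg (Measure.map φ) (h t)
  rwa [Measure.map_map hφ (hm t), Measure.map_map hφ (hm 0)] at this

theorem IsStationary.map_past_eq {Y : EventSeq S X Ω} {P : Measure Ω} (h : Y.IsStationary P) (t : ℝ) :
    P.map (Y.past t) = P.map (Y.past 0) :=
  h.map_eq t (φ := fun p : (ℕ → S × X × ℝ) × FutureList X => fun k => (p.1 k).2)
    (by fun_prop)

theorem condDistrib_int_past {Y : EventSeq S X Ω} {P : Measure Ω} [IsFiniteMeasure P]
    [Countable S] [DiscreteMeasurableSpace S] [Nonempty S] (h : Y.IsStationary P) (t : ℝ) :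
    condDistrib (fun ω => Y.int (Y.cur t ω) ω) (Y.past t) P =
      condDistrib (fun ω => Y.int (Y.cur 0 ω) ω) (Y.past 0) P := by
  have hφ : Measurable fun p : (ℕ → S × X × ℝ) × FutureList X =>
    ((fun k => (p.1 k).2 : PastList X), (p.1 0).1) := by fun_prop
  have := h.map_eq t hφ
  simp only [fullPast, Nat.cast_zero, sub_zero] at this
  simp only [condDistrib, this]

section Emission

variable [DiscreteMeasurableSpace X] [Fintype X] [Countable S] [DiscreteMeasurableSpace S]
  {Y : EventSeq S X Ω} {P : Measure Ω} {M : UHSMM S X}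

/-- Generation conditions on the present symbol, so only the next one is seen being drawn. A
forbidden symbol has model probability zero, and there are countably many triples to exclude. -/
theorem ae_emit_succ_cur_ne_zero (hgen : Y.IsGeneratedBy P M) (t : ℝ) :
    ∀ᵐ ω ∂P, M.emit (Y.int (Y.cur t ω + 1) ω) (Y.sym (Y.cur t ω + 1) ω) ≠ 0 := by
  have key : ∀ (g : S) (x x' : X), M.emit (M.next g x) x' = 0 →
      ∀ᵐ ω ∂P, ¬ (Y.int (Y.cur t ω) ω = g ∧ Y.sym (Y.cur t ω) ω = x ∧
        Y.sym (Y.cur t ω + 1) ω = x') := by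
    intro g x x' h0
    have hm : Measurable fun q : ℕ → S × X × ℝ => ((q 0).1, (q 0).2.1) := by fun_prop
    have hA : MeasurableSet {q : ℕ → S × X × ℝ | (q 0).1 = g ∧ (q 0).2.1 = x} := by
      convert hm (measurableSet_singleton (g, x)) using 1
      ext q; simp
    have := hgen.2 t _ [univ, {p | p.1 = x'}] hA (by
      simp only [List.mem_cons, List.not_mem_nil, or_false, forall_eq_or_imp, forall_eq]
      exact ⟨.univ, measurable_fst (measurableSet_singleton x')⟩)
    have hA' : MeasurableSet {ω | Y.fullPast t ω ∈ {q : ℕ → S × X × ℝ | (q 0).1 = g ∧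
        (q 0).2.1 = x}} := Y.measurable_fullPast t hA
    rw [setLIntegral_congr_fun (g := fun _ => 0) hA', lintegral_zero] at this
    · rw [ae_iff]
      refine measure_mono_null (fun ω hω => ?_) this
      simp only [not_not] at hω
      obtain ⟨h1, h2, h3⟩ := hω
      refine ⟨⟨by simpa [fullPast] using h1, by simpa [fullPast, past] using h2⟩, ?_⟩
      show Y.future t ω ∈ cylinderOf _
      rw [mem_cylinderOf_cons, mem_cylinderOf_cons, cylinderOf_nil]
      simpa [future] using h3
    · rintro ω ⟨h1, h2⟩
      rw [← hidden_eq_fullPast] at h1 h2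
      simp only [UHSMM.futureProb, UHSMM.eventProb, h1, h2]
      rw [Finset.sum_eq_zero, mul_zero]
      intro y _
      by_cases hy : y = x'
      · rw [hy, h0]; simp
      · simp [hy]
  have hall : ∀ᵐ ω ∂P, ∀ (g : S) (x x' : X), M.emit (M.next g x) x' = 0 →
      ¬ (Y.int (Y.cur t ω) ω = g ∧ Y.sym (Y.cur t ω) ω = x ∧
        Y.sym (Y.cur t ω + 1) ω = x') := by
    simp only [ae_all_iff]
    exact key
  filter_upwards [hall] with ω hω h
  rw [hgen.1] at h
  exact hω _ _ _ h ⟨rfl, rfl, rfl⟩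

theorem ae_sym_succ_ne (hgen : Y.IsGeneratedBy P M) :
    ∀ᵐ ω ∂P, ∀ n, Y.sym (n + 1) ω ≠ Y.sym n ω := by
  have hall : ∀ᵐ ω ∂P, ∀ q : ℚ,
      M.emit (Y.int (Y.cur q ω + 1) ω) (Y.sym (Y.cur q ω + 1) ω) ≠ 0 :=
    ae_all_iff.2 fun q => ae_emit_succ_cur_ne_zero hgen q
  filter_upwards [hall] with ω hω
  have hemit : ∀ n, M.emit (Y.int n ω) (Y.sym n ω) ≠ 0 := fun n => by
    -- Every event is the next one at some rational time, so countably many null sets suffice.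
    obtain ⟨q, h1, h2⟩ := exists_rat_btwn (Y.strictMono_time ω (sub_one_lt n))
    have h3 := (Y.le_cur_iff q ω (n - 1)).2 h1.le
    have h4 := (Y.cur_lt_iff q ω n).2 h2
    have h5 : Y.cur q ω + 1 = n := by omega
    exact h5 ▸ hω q
  intro n h
  have h1 := M.emit_ne _ _ (hemit n)
  have h2 := hemit (n + 1)
  rw [hgen.1, h] at h2
  exact h2 h1

end Emission

variable [DiscreteMeasurableSpace X] [Fintype X] [Nonempty X]

/-- The conditional law of the future given the hidden state. -/
def futureKernel (Y : EventSeq S X Ω) (P : Measure Ω) [IsFiniteMeasure P] :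
    Kernel (HiddenState S X) (FutureList X) :=
  condDistrib (Y.future 0) (Y.hidden 0) P

instance (Y : EventSeq S X Ω) (P : Measure Ω) [IsFiniteMeasure P] :
    IsMarkovKernel (Y.futureKernel P) := by
  unfold futureKernel; infer_instance

variable {Y : EventSeq S X Ω} {P : Measure Ω} [IsProbabilityMeasure P] {M : UHSMM S X}

theorem condDistrib_future_hidden (h : Y.IsStationary P) (t : ℝ) :
    condDistrib (Y.future t) (Y.hidden t) P = Y.futureKernel P := by
  have hφ : Measurable fun p : (ℕ → S × X × ℝ) × FutureList X => (p.1 0, p.2) := by fun_prop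
  have := h.map_eq t hφ
  simp only [← hidden_eq_fullPast] at this
  simp only [futureKernel, condDistrib, this]

theorem condDistrib_future_past (h : Y.IsStationary P) (t : ℝ) :
    condDistrib (Y.future t) (Y.past t) P = condDistrib (Y.future 0) (Y.past 0) P := by
  have hφ : Measurable fun p : (ℕ → S × X × ℝ) × FutureList X =>
    ((fun k => (p.1 k).2 : PastList X), p.2) := by fun_prop
  have := h.map_eq t hφ
  change P.map (fun ω => (Y.past t ω, Y.future t ω)) =
    P.map (fun ω => (Y.past 0 ω, Y.future 0 ω)) at this
  simp only [condDistrib, this]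

section Generated

variable [Countable S] [DiscreteMeasurableSpace S]

theorem futureKernel_cylinderOf (hstat : Y.IsStationary P) (hgen : Y.IsGeneratedBy P M) (t : ℝ)
    {Bs : List (Set (X × ℝ))} (hBs : ∀ B ∈ Bs, MeasurableSet B) :
    ∀ᵐ ω ∂P, Y.futureKernel P (Y.hidden t ω) (cylinderOf Bs) =
      M.futureProb (Y.hidden t ω) Bs := by
  have hh := Y.measurable_hidden t
  have hC := measurableSet_cylinderOf hBs
  have hf := M.measurable_futureProb hBs
  have hκ := (Y.futureKernel P).measurable_coe hC
  refine ae_of_ae_map (p := fun z => Y.futureKernel P z (cylinderOf Bs) = M.futureProb z Bs)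
    hh.aemeasurable ?_
  refine ae_eq_of_forall_setLIntegral_eq_of_sigmaFinite hκ hf fun A hA _ => ?_
  rw [setLIntegral_map hA hκ hh, setLIntegral_map hA hf hh, ← condDistrib_future_hidden hstat t,
    setLIntegral_preimage_condDistrib hh (Y.measurable_future t).aemeasurable hC hA]
  have h0 : Measurable fun q : ℕ → S × X × ℝ => q 0 := measurable_pi_apply 0
  have := hgen.2 t ((fun q => q 0) ⁻¹' A) Bs (h0 hA) hBs
  simp only [mem_preimage, ← hidden_eq_fullPast] at this
  exact this

/-- Generation from cylinders to all measurable sets, by a π-system argument: given the full past,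
only the hidden state matters. -/
theorem measure_inter_future (hstat : Y.IsStationary P) (hgen : Y.IsGeneratedBy P M) (t : ℝ)
    {A : Set (ℕ → S × X × ℝ)} (hA : MeasurableSet A) {B : Set (FutureList X)}
    (hB : MeasurableSet B) :
    P (Y.fullPast t ⁻¹' A ∩ Y.future t ⁻¹' B) =
      ∫⁻ ω in Y.fullPast t ⁻¹' A, Y.futureKernel P (Y.hidden t ω) B ∂P := by
  have hf := Y.measurable_future t
  have hA' := Y.measurable_fullPast t hA
  have hk : Measurable fun ω => Y.futureKernel P (Y.hidden t ω) :=
    (Y.futureKernel P).measurable.comp (Y.measurable_hidden t)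
  have key : (P.restrict (Y.fullPast t ⁻¹' A)).map (Y.future t) =
      (P.restrict (Y.fullPast t ⁻¹' A)).bind fun ω => Y.futureKernel P (Y.hidden t ω) := by
    refine ext_of_generate_finite _ generateFrom_measurableCylindersOf.symm
      isPiSystem_measurableCylindersOf ?_ ?_
    · rintro _ ⟨Bs, hBs, rfl⟩
      have hC := measurableSet_cylinderOf hBs
      rw [Measure.map_apply hf hC, Measure.restrict_apply (hf hC), inter_comm,
        Measure.bind_apply hC hk.aemeasurable]
      refine (hgen.2 t A Bs hA hBs).trans ?_
      refine lintegral_congr_ae (ae_restrict_of_ae ?_)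
      filter_upwards [futureKernel_cylinderOf hstat hgen t hBs] with ω hω using hω.symm
    · rw [Measure.map_apply hf .univ, Measure.bind_apply .univ hk.aemeasurable]
      simp
  have := congrArg (fun μ => μ B) key
  rwa [Measure.map_apply hf hB, Measure.restrict_apply (hf hB), inter_comm,
    Measure.bind_apply hB hk.aemeasurable] at this

theorem measure_inter_future_of_comap (hstat : Y.IsStationary P) (hgen : Y.IsGeneratedBy P M)
    (t : ℝ) {E : Set Ω} (hE : MeasurableSet[MeasurableSpace.comap (Y.fullPast t) inferInstance] E)
    {B : Set (FutureList X)} (hB : MeasurableSet B) :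
    P (E ∩ Y.future t ⁻¹' B) = ∫⁻ ω in E, Y.futureKernel P (Y.hidden t ω) B ∂P := by
  obtain ⟨A, hA, rfl⟩ := hE
  exact measure_inter_future hstat hgen t hA hB

variable (Y P M) in
/-- The hidden states for which the conditional law of the future is the one of the model. -/
theorem exists_measurableSet_futureKernel_cylinderOf (hstat : Y.IsStationary P)
    (hgen : Y.IsGeneratedBy P M) :
    ∃ G : Set (HiddenState S X), MeasurableSet G ∧ (∀ t, ∀ᵐ ω ∂P, Y.hidden t ω ∈ G) ∧
      ∀ z ∈ G, ∀ Bs : List (Set (X × ℝ)), (∀ B ∈ Bs, MeasurableSet B) →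
        Y.futureKernel P z (cylinderOf Bs) = M.futureProb z Bs := by
  -- A countable algebra of sides gives countably many cylinders, hence one common exceptional set;
  -- `cylinderOf_eq_futureProb` then covers all measurable sides.
  obtain ⟨b, hbc, hb⟩ :=
    (inferInstance : MeasurableSpace.CountablyGenerated (X × ℝ)).isCountablyGenerated
  have h𝒜 := isSetAlgebra_generateSetAlgebra (𝒜 := b)
  have hgenA : MeasurableSpace.generateFrom (generateSetAlgebra b) =
      (inferInstance : MeasurableSpace (X × ℝ)) := by
    rw [generateFrom_generateSetAlgebra_eq]; exact hb.symm
  have hmeas : ∀ B ∈ generateSetAlgebra b, MeasurableSet B := fun B hB => by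
    have := MeasurableSpace.measurableSet_generateFrom hB
    rwa [hgenA] at this
  have hc : Countable (generateSetAlgebra b) := (countable_generateSetAlgebra hbc).to_subtype
  have hL : ∀ L : List (generateSetAlgebra b), ∀ B ∈ L.map Subtype.val, MeasurableSet B :=
    fun L B hB => by
      obtain ⟨C, -, rfl⟩ := List.mem_map.1 hB
      exact hmeas _ C.2
  refine ⟨⋂ L : List (generateSetAlgebra b),
    {z | Y.futureKernel P z (cylinderOf (L.map Subtype.val)) =
      M.futureProb z (L.map Subtype.val)}, ?_, fun t => ?_, fun z hz => ?_⟩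
  · exact MeasurableSet.iInter fun L => measurableSet_eq_fun
      ((Y.futureKernel P).measurable_coe (measurableSet_cylinderOf (hL L)))
      (M.measurable_futureProb (hL L))
  · simp only [mem_iInter]
    exact ae_all_iff.2 fun L => futureKernel_cylinderOf hstat hgen t (hL L)
  · refine M.cylinderOf_eq_futureProb z _ h𝒜 hgenA fun Bs hBs => ?_
    lift Bs to List (generateSetAlgebra b) using hBs
    exact mem_iInter.1 hz Bs

end Generated

end EventSeq

end

/-! ### Posterior probabilities of an updated state. -/

noncomputable section

section StateEstimate

variable {Ω S : Type*} {m m' m₀ : MeasurableSpace Ω} {P : Measure Ω} [IsProbabilityMeasure P]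

theorem memLp_two_condExp_indicator (m : MeasurableSpace Ω) {A : Set Ω}
    (hA : MeasurableSet[m₀] A) :
    MemLp (P⟦A | m⟧) 2 P :=
  MemLp.condExp (by norm_num) ((memLp_const (1 : ℝ)).indicator hA)

/-- Pythagoras for the conditional probabilities of an event given two nested σ-algebras. -/
theorem integral_sub_sq_condExp (hmm : m ≤ m') (hm' : m' ≤ m₀) {A : Set Ω}
    (hA : MeasurableSet A) :
    ∫ ω, ((P⟦A | m'⟧) ω - (P⟦A | m⟧) ω) ^ 2 ∂P =
      ∫ ω, ((P⟦A | m'⟧) ω) ^ 2 ∂P - ∫ ω, ((P⟦A | m⟧) ω) ^ 2 ∂P := by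
  have hp := memLp_two_condExp_indicator (P := P) m' hA
  have hq := memLp_two_condExp_indicator (P := P) m hA
  have hqp : Integrable (P⟦A | m⟧ * P⟦A | m'⟧) P := hq.integrable_mul hp
  have hcross : ∫ ω, (P⟦A | m⟧ * P⟦A | m'⟧) ω ∂P = ∫ ω, ((P⟦A | m⟧) ω) ^ 2 ∂P := by
    rw [← integral_condExp (hmm.trans hm')]
    refine integral_congr_ae ?_
    have h1 : P[P⟦A | m⟧ * P⟦A | m'⟧ | m] =ᵐ[P] P⟦A | m⟧ * P[P⟦A | m'⟧ | m] :=
      condExp_mul_of_stronglyMeasurable_left stronglyMeasurable_condExp hqp integrable_condExp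
    have h2 : P[P⟦A | m'⟧ | m] =ᵐ[P] P⟦A | m⟧ := condExp_condExp_of_le hmm hm'
    filter_upwards [h1, h2] with ω h1 h2
    rw [h1, Pi.mul_apply, h2, sq]
  have hexp : ∀ ω, ((P⟦A | m'⟧) ω - (P⟦A | m⟧) ω) ^ 2 =
      ((P⟦A | m'⟧) ω) ^ 2 - 2 * (P⟦A | m⟧ * P⟦A | m'⟧) ω + ((P⟦A | m⟧) ω) ^ 2 := fun ω => by
    rw [Pi.mul_apply]; ring
  simp only [hexp]
  have hsub : Integrable (fun ω =>
      ((P⟦A | m'⟧) ω) ^ 2 - 2 * (P⟦A | m⟧ * P⟦A | m'⟧) ω) P :=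
    hp.integrable_sq.sub (hqp.const_mul 2)
  rw [integral_add hsub hq.integrable_sq, integral_sub hp.integrable_sq (hqp.const_mul 2),
    integral_const_mul, hcross]
  ring

variable [Fintype S]

/-- If a state is updated by a function of what is observed, then the estimate of the new state
has at least as large a sum of squares as the estimate of the old one. -/
theorem sum_sq_condExp_le_of_update {g g' : Ω → S} (hg : ∀ s, MeasurableSet (g ⁻¹' {s}))
    {U : S → S → Set Ω} (hm' : m' ≤ m₀) (hU : ∀ s s', MeasurableSet[m'] (U s s'))
    (hUg : ∀ ω s s', ω ∈ U s s' → g ω = s → g' ω = s') (hUex : ∀ ω s, ∃! s', ω ∈ U s s') :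
    ∀ᵐ ω ∂P, ∑ s, ((P⟦g ⁻¹' {s} | m'⟧) ω) ^ 2 ≤ ∑ s, ((P⟦g' ⁻¹' {s} | m'⟧) ω) ^ 2 := by
  classical
  have hint : ∀ s, Integrable ((g ⁻¹' {s}).indicator fun _ => (1 : ℝ)) P := fun s =>
    (integrable_const 1).indicator (hg s)
  -- Given what is observed, the update is a known map of states, so the new posterior is the image
  -- of the old one.
  have hpush : ∀ s', P⟦g' ⁻¹' {s'} | m'⟧ =ᵐ[P]
      ∑ s, (U s s').indicator (P⟦g ⁻¹' {s} | m'⟧) := fun s' => by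
    have h1 : (g' ⁻¹' {s'}).indicator (fun _ => (1 : ℝ)) =
        ∑ s, (U s s').indicator ((g ⁻¹' {s}).indicator fun _ => (1 : ℝ)) := by
      ext ω
      rw [Finset.sum_apply, Finset.sum_eq_single (g ω)]
      · obtain ⟨s'', h1, h2⟩ := hUex ω (g ω)
        have h3 := hUg ω _ _ h1 rfl
        by_cases h : ω ∈ U (g ω) s'
        · simp [h, hUg ω _ _ h rfl]
        · have : g' ω ≠ s' := fun h' => h (by rw [← h', h3]; exact h1)
          simp [h, this]
      · intro s _ hs
        have : ω ∉ g ⁻¹' {s} := fun h => hs (by simpa using h.symm)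
        simp [indicator, hs.symm]
      · simp
    rw [h1]
    refine (condExp_finsetSum (fun s _ => (hint s).indicator (hm' _ (hU s s'))) m').trans ?_
    have h2 := ae_all_iff.2 fun s => condExp_indicator (μ := P) (hint s) (hU s s')
    filter_upwards [h2] with ω hω
    rw [Finset.sum_apply, Finset.sum_apply]
    exact Finset.sum_congr rfl fun s _ => hω s
  have hnonneg : ∀ᵐ ω ∂P, ∀ s, 0 ≤ (P⟦g ⁻¹' {s} | m'⟧) ω := ae_all_iff.2 fun s =>
    condExp_nonneg (ae_of_all _ fun ω => indicator_nonneg (fun _ _ => zero_le_one) ω)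
  filter_upwards [ae_all_iff.2 hpush, hnonneg] with ω hω h0
  calc ∑ s, ((P⟦g ⁻¹' {s} | m'⟧) ω) ^ 2
      = ∑ s, ∑ s', ((U s s').indicator (P⟦g ⁻¹' {s} | m'⟧) ω) ^ 2 := by
        refine Finset.sum_congr rfl fun s _ => ?_
        obtain ⟨s', h1, h2⟩ := hUex ω s
        rw [Finset.sum_eq_single s', indicator_of_mem h1]
        · intro s'' _ hs
          rw [indicator_of_notMem fun h => hs (h2 s'' h)]
          norm_num
        · simp
    _ = ∑ s', ∑ s, ((U s s').indicator (P⟦g ⁻¹' {s} | m'⟧) ω) ^ 2 := Finset.sum_comm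
    -- Merging nonnegative masses does not decrease the sum of squares.
    _ ≤ ∑ s', ((P⟦g' ⁻¹' {s'} | m'⟧) ω) ^ 2 := by
        refine Finset.sum_le_sum fun s' _ => ?_
        rw [hω s', Finset.sum_apply]
        exact Finset.sum_sq_le_sq_sum_of_nonneg fun s _ => indicator_apply_nonneg fun _ => h0 s

/-- If a state is updated by a function of what is observed, and the new state is not better
estimated than the old one, then what is observed meanwhile is no evidence about the old state. -/
theorem condExp_ae_eq_of_update {g g' : Ω → S} (hg : ∀ s, MeasurableSet (g ⁻¹' {s}))
    (hg' : ∀ s, MeasurableSet (g' ⁻¹' {s})) {U : S → S → Set Ω} (hmm : m ≤ m') (hm' : m' ≤ m₀)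
    (hU : ∀ s s', MeasurableSet[m'] (U s s'))
    (hUg : ∀ ω s s', ω ∈ U s s' → g ω = s → g' ω = s') (hUex : ∀ ω s, ∃! s', ω ∈ U s s')
    (hV : ∑ s, ∫ ω, ((P⟦g' ⁻¹' {s} | m'⟧) ω) ^ 2 ∂P = ∑ s, ∫ ω, ((P⟦g ⁻¹' {s} | m⟧) ω) ^ 2 ∂P)
    (s : S) : P⟦g ⁻¹' {s} | m'⟧ =ᵐ[P] P⟦g ⁻¹' {s} | m⟧ := by
  have hle : ∑ s, ∫ ω, ((P⟦g ⁻¹' {s} | m'⟧) ω) ^ 2 ∂P ≤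
      ∑ s, ∫ ω, ((P⟦g' ⁻¹' {s} | m'⟧) ω) ^ 2 ∂P := by
    have hi : ∀ s, Integrable (fun ω => ((P⟦g ⁻¹' {s} | m'⟧) ω) ^ 2) P := fun s =>
      (memLp_two_condExp_indicator m' (hg s)).integrable_sq
    have hi' : ∀ s, Integrable (fun ω => ((P⟦g' ⁻¹' {s} | m'⟧) ω) ^ 2) P := fun s =>
      (memLp_two_condExp_indicator m' (hg' s)).integrable_sq
    rw [← integral_finsetSum _ fun s _ => hi s, ← integral_finsetSum _ fun s _ => hi' s]
    exact integral_mono_ae (integrable_finsetSum _ fun s _ => hi s)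
      (integrable_finsetSum _ fun s _ => hi' s) (sum_sq_condExp_le_of_update hg hm' hU hUg hUex)
  have hnn : ∀ s, 0 ≤ ∫ ω, ((P⟦g ⁻¹' {s} | m'⟧) ω - (P⟦g ⁻¹' {s} | m⟧) ω) ^ 2 ∂P := fun s =>
    integral_nonneg fun ω => sq_nonneg _
  -- By Pythagoras the total squared change is the gain from `m` to `m'`, which `hle` and `hV` leave
  -- no room for.
  have hsum : ∑ s, ∫ ω, ((P⟦g ⁻¹' {s} | m'⟧) ω - (P⟦g ⁻¹' {s} | m⟧) ω) ^ 2 ∂P ≤ 0 := by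
    simp only [integral_sub_sq_condExp hmm hm' (hg _), Finset.sum_sub_distrib]
    linarith
  have hzero := (Finset.sum_eq_zero_iff_of_nonneg fun s _ => hnn s).1
    (le_antisymm hsum (Finset.sum_nonneg fun s _ => hnn s)) s (Finset.mem_univ s)
  rw [integral_eq_zero_iff_of_nonneg (fun ω => sq_nonneg _)] at hzero
  · filter_upwards [hzero] with ω hω
    exact sub_eq_zero.1 (pow_eq_zero_iff two_ne_zero |>.1 hω)
  · exact ((memLp_two_condExp_indicator m' (hg s)).sub
      (memLp_two_condExp_indicator m (hg s))).integrable_sq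

end StateEstimate

/-! ### Conditional laws tested on rectangles. -/

section CondDistrib

variable {Ω α β : Type*} [MeasurableSpace Ω] [MeasurableSpace α] [MeasurableSpace β]
  [StandardBorelSpace β] [Nonempty β] {P : Measure Ω} [IsFiniteMeasure P]

theorem condDistrib_ae_eq_of_forall_inter {V : Ω → α} {Z : Ω → β} (hV : Measurable V)
    (hZ : Measurable Z) (k : Kernel α β) [IsFiniteKernel k]
    (h : ∀ A B, MeasurableSet A → MeasurableSet B →
      P (V ⁻¹' A ∩ Z ⁻¹' B) = ∫⁻ ω in V ⁻¹' A, k (V ω) B ∂P) :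
    ∀ᵐ ω ∂P, condDistrib Z V P (V ω) = k (V ω) := by
  refine ae_of_ae_map (p := fun v => condDistrib Z V P v = k v) hV.aemeasurable ?_
  refine condDistrib_ae_eq_of_measure_eq_compProd V hZ.aemeasurable (Measure.ext_prod ?_)
  intro A B hA hB
  rw [Measure.map_apply (hV.prodMk hZ) (hA.prod hB), mk_preimage_prod, h A B hA hB,
    Measure.compProd_apply_prod hA hB, setLIntegral_map hA (k.measurable_coe hB) hV]

/-- Integrating out `Z` given `V`. Used with `Z` the future and with `Z` the internal state, it
turns their conditional independence into a symmetric product. -/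
theorem setLIntegral_inter_condDistrib {V : Ω → α} {Z : Ω → β} (hV : Measurable V)
    (hZ : Measurable Z) {A : Set α} {B : Set β} (hA : MeasurableSet A) (hB : MeasurableSet B)
    {w : α → ℝ≥0∞} (hw : Measurable w) :
    ∫⁻ ω in V ⁻¹' A ∩ Z ⁻¹' B, w (V ω) ∂P =
      ∫⁻ ω in V ⁻¹' A, w (V ω) * condDistrib Z V P (V ω) B ∂P := by
  classical
  have hf : Measurable fun p : α × β => (A ×ˢ B).indicator (fun p => w p.1) p :=
    (hw.comp measurable_fst).indicator (hA.prod hB)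
  have h1 : ∫⁻ p, (A ×ˢ B).indicator (fun p => w p.1) p ∂(P.map V ⊗ₘ condDistrib Z V P) =
      ∫⁻ p, (A ×ˢ B).indicator (fun p => w p.1) p ∂P.map fun ω => (V ω, Z ω) := by
    rw [compProd_map_condDistrib hZ.aemeasurable]
  rw [Measure.lintegral_compProd hf, lintegral_map hf (hV.prodMk hZ)] at h1
  rw [← lintegral_indicator ((hV hA).inter (hZ hB)), ← lintegral_indicator (hV hA)]
  have hm : Measurable fun v => ∫⁻ z, (A ×ˢ B).indicator (fun p => w p.1) (v, z)
      ∂condDistrib Z V P v := hf.lintegral_kernel_prod_right'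
  rw [lintegral_map hm hV] at h1
  refine Eq.trans ?_ (h1.symm.trans ?_)
  · refine lintegral_congr fun ω => ?_
    simp only [indicator_apply]
    exact if_congr (by simp) rfl rfl
  · refine lintegral_congr fun ω => ?_
    by_cases hω : V ω ∈ A
    · have : ∀ z, (A ×ˢ B).indicator (fun p => w p.1) (V ω, z) =
          B.indicator (fun _ => w (V ω)) z := fun z => by
        simp only [indicator_apply]
        exact if_congr (by simp [hω]) rfl rfl
      simp only [this]
      rw [lintegral_indicator_const hB, indicator_of_mem (mem_preimage.2 hω)]
    · simp [indicator, hω]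

end CondDistrib

end

/-! ### The past predicts as well as the hidden state. -/

noncomputable section

namespace EventSeq

open FutureList

variable {S X : Type} {Ω : Type*} [MeasurableSpace S] [MeasurableSpace X] [MeasurableSpace Ω]

/-- The internal state at time `t`. -/
def internal (Y : EventSeq S X Ω) (t : ℝ) (ω : Ω) : S := Y.int (Y.cur t ω) ω

theorem measurable_internal (Y : EventSeq S X Ω) (t : ℝ) : Measurable (Y.internal t) :=
  Y.measurable_int_index (Y.measurable_cur t)

theorem hidden_eq_internal (Y : EventSeq S X Ω) (t : ℝ) (ω : Ω) :
    Y.hidden t ω = (Y.internal t ω, Y.past t ω 0) := Y.hidden_eq_past t ω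

/-- The σ-algebra of the observed past. -/
abbrev observedPast (Y : EventSeq S X Ω) (t : ℝ) : MeasurableSpace Ω :=
  MeasurableSpace.comap (Y.past t) inferInstance

theorem observedPast_le (Y : EventSeq S X Ω) (t : ℝ) :
    Y.observedPast t ≤ (inferInstance : MeasurableSpace Ω) :=
  (Y.measurable_past t).comap_le

theorem observedPast_mono (Y : EventSeq S X Ω) : Monotone Y.observedPast := fun u t h => by
  rw [← measurable_iff_comap_le]
  exact Y.measurable_past_of_le h (comap_measurable _)

theorem measurable_future_iSup_observedPast (Y : EventSeq S X Ω) (t : ℝ) :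
    Measurable[⨆ n : ℕ, Y.observedPast (t + n)] (Y.future t) := by
  refine Y.measurable_future_of_observe fun n => ?_
  have := Y.measurable_observe_future (t := t) (m := Y.observedPast (t + n)) n.cast_nonneg
    (comap_measurable _)
  exact this.mono (le_iSup (fun n : ℕ => Y.observedPast (t + n)) n) le_rfl

variable [Fintype S] [DiscreteMeasurableSpace S] {Y : EventSeq S X Ω} {P : Measure Ω}
  [IsProbabilityMeasure P]

/-- The quantity depends only on the joint law of past and internal state. -/
theorem sum_integral_sq_condExp_internal (hstat : Y.IsStationary P) (t : ℝ) :
    ∑ s, ∫ ω, ((P⟦Y.internal t ⁻¹' {s} | Y.observedPast t⟧) ω) ^ 2 ∂P =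
      ∑ s, ∫ ω, ((P⟦Y.internal 0 ⁻¹' {s} | Y.observedPast 0⟧) ω) ^ 2 ∂P := by
  have : Nonempty S := (nonempty_of_isProbabilityMeasure P).map (Y.internal 0)
  have key : ∀ (t : ℝ) (s : S), ∫ ω, ((P⟦Y.internal t ⁻¹' {s} | Y.observedPast t⟧) ω) ^ 2 ∂P =
      ∫ y, ((condDistrib (Y.internal 0) (Y.past 0) P y).real {s}) ^ 2 ∂(P.map (Y.past 0)) := by
    intro t s
    rw [← hstat.map_past_eq t, integral_map (Y.measurable_past t).aemeasurable]
    · refine integral_congr_ae ?_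
      filter_upwards [condDistrib_ae_eq_condExp (μ := P) (Y.measurable_past t)
        (Y.measurable_internal t) (measurableSet_singleton s)] with ω hω
      rw [← hω]
      have := condDistrib_int_past hstat t
      unfold internal
      rw [this]
    · exact (((condDistrib (Y.internal 0) (Y.past 0) P).measurable_coe
        (measurableSet_singleton s)).ennreal_toReal.pow_const 2).aestronglyMeasurable
  simp only [key]

variable [Fintype X] [DiscreteMeasurableSpace X] {M : UHSMM S X}

theorem condExp_internal_observedPast_add (hstat : Y.IsStationary P)
    (hgen : Y.IsGeneratedBy P M) (t : ℝ) (n : ℕ) (s : S) :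
    P⟦Y.internal t ⁻¹' {s} | Y.observedPast (t + n)⟧ =ᵐ[P]
      P⟦Y.internal t ⁻¹' {s} | Y.observedPast t⟧ := by
  have : Nonempty X := (nonempty_of_isProbabilityMeasure P).map (Y.sym 0)
  let x₀ : X := Classical.arbitrary X
  have hn : (0 : ℝ) ≤ n := n.cast_nonneg
  have hobs := Y.measurable_observe_future (m := Y.observedPast (t + n)) hn
    (comap_measurable _)
  -- The symbol and the age are dummies: the internal component of `advance` ignores them.
  let ψ : S → Ω → S := fun s ω => (M.advance n (s, x₀, 0) (observe n (Y.future t ω))).1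
  have hψ : ∀ s, Measurable[Y.observedPast (t + n)] (ψ s) := fun s =>
    measurable_fst.comp ((M.measurable_advance n).comp (measurable_const.prodMk hobs))
  refine condExp_ae_eq_of_update (g' := Y.internal (t + n)) (U := fun s s' => ψ s ⁻¹' {s'})
    (fun s => Y.measurable_internal t (measurableSet_singleton s))
    (fun s => Y.measurable_internal _ (measurableSet_singleton s))
    (Y.observedPast_mono (by linarith)) (Y.observedPast_le _)
    (fun s s' => hψ s (measurableSet_singleton s')) ?_ ?_ ?_ s
  · rintro ω s s' rfl rfl
    exact congrArg Prod.fst (Y.hidden_add hgen.1 hn (t := t) (ω := ω))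
  · intro ω s
    exact ⟨ψ s ω, rfl, fun s' h => h.symm⟩
  · rw [sum_integral_sq_condExp_internal hstat (t + n), sum_integral_sq_condExp_internal hstat t]

/-- The future is no evidence about the internal state beyond the past. -/
theorem condExp_internal_iSup_observedPast (hstat : Y.IsStationary P)
    (hgen : Y.IsGeneratedBy P M) (t : ℝ) (s : S) :
    P⟦Y.internal t ⁻¹' {s} | ⨆ n : ℕ, Y.observedPast (t + n)⟧ =ᵐ[P]
      P⟦Y.internal t ⁻¹' {s} | Y.observedPast t⟧ := by
  let ℱ : Filtration ℕ (inferInstance : MeasurableSpace Ω) :=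
    { seq := fun n => Y.observedPast (t + n)
      mono' := fun i j h => Y.observedPast_mono (by simpa using h)
      le' := fun n => Y.observedPast_le _ }
  -- Lévy's upward theorem for a sequence that is almost surely constant.
  have h1 := tendsto_ae_condExp (μ := P) (ℱ := ℱ)
    ((Y.internal t ⁻¹' {s}).indicator fun _ => (1 : ℝ))
  have h2 := ae_all_iff.2 fun n => condExp_internal_observedPast_add hstat hgen t n s
  filter_upwards [h1, h2] with ω h1 h2
  exact tendsto_nhds_unique h1 (tendsto_const_nhds.congr fun n => (h2 n).symm)

variable [Nonempty S]

theorem setLIntegral_condDistrib_internal (hstat : Y.IsStationary P)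
    (hgen : Y.IsGeneratedBy P M) (t : ℝ) (s : S) {A : Set (PastList X)} (hA : MeasurableSet A)
    {B : Set (FutureList X)} (hB : MeasurableSet B) :
    ∫⁻ ω in Y.past t ⁻¹' A ∩ Y.future t ⁻¹' B,
        condDistrib (Y.internal t) (Y.past t) P (Y.past t ω) {s} ∂P =
      P (Y.past t ⁻¹' A ∩ Y.future t ⁻¹' B ∩ Y.internal t ⁻¹' {s}) := by
  have hm : (⨆ n : ℕ, Y.observedPast (t + n)) ≤ (inferInstance : MeasurableSpace Ω) :=
    iSup_le fun n => Y.observedPast_le _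
  have hs : MeasurableSet (Y.internal t ⁻¹' {s}) :=
    Y.measurable_internal t (measurableSet_singleton s)
  have hE : MeasurableSet[⨆ n : ℕ, Y.observedPast (t + n)]
      (Y.past t ⁻¹' A ∩ Y.future t ⁻¹' B) := by
    refine MeasurableSet.inter ?_ (Y.measurable_future_iSup_observedPast t hB)
    have h0 : Y.observedPast (t + (0 : ℕ)) ≤ ⨆ n : ℕ, Y.observedPast (t + n) :=
      le_iSup (fun n : ℕ => Y.observedPast (t + n)) 0
    refine h0 _ ?_
    rw [Nat.cast_zero, add_zero]
    exact ⟨A, hA, rfl⟩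
  have hi : Integrable ((Y.internal t ⁻¹' {s}).indicator fun _ => (1 : ℝ)) P :=
    (integrable_const 1).indicator hs
  have h1 := setIntegral_condExp hm hi hE
  have h2 : ∀ᵐ ω ∂P, (P⟦Y.internal t ⁻¹' {s} | ⨆ n : ℕ, Y.observedPast (t + n)⟧) ω =
      (condDistrib (Y.internal t) (Y.past t) P (Y.past t ω) {s}).toReal := by
    filter_upwards [condExp_internal_iSup_observedPast hstat hgen t s,
      condDistrib_ae_eq_condExp (μ := P) (Y.measurable_past t)
        (Y.measurable_internal t) (measurableSet_singleton s)] with ω h h'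
    rw [h, ← h']
    rfl
  have hmeas : Measurable fun ω => condDistrib (Y.internal t) (Y.past t) P (Y.past t ω) {s} :=
    ((condDistrib (Y.internal t) (Y.past t) P).measurable_coe (measurableSet_singleton s)).comp
      (Y.measurable_past t)
  rw [setIntegral_congr_ae (hm _ hE) (h2.mono fun ω h _ => h),
    integral_toReal hmeas.aemeasurable (ae_of_all _ fun ω => measure_lt_top _ _),
    integral_indicator_const _ hs, smul_eq_mul, mul_one, measureReal_def,
    Measure.restrict_apply hs, inter_comm (Y.internal t ⁻¹' {s})] at h1
  refine (ENNReal.toReal_eq_toReal_iff' ?_ (measure_ne_top _ _)).1 h1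
  refine ne_of_lt (lt_of_le_of_lt (lintegral_mono fun ω => prob_le_one) ?_)
  simp

variable [Nonempty X]

/-- The conditional law of the future given the past is the one given the hidden state. -/
theorem condDistrib_past_eq_futureKernel (hstat : Y.IsStationary P)
    (hgen : Y.IsGeneratedBy P M) (t : ℝ) :
    ∀ᵐ ω ∂P, condDistrib (Y.future t) (Y.past t) P (Y.past t ω) =
      Y.futureKernel P (Y.hidden t ω) := by
  have hp := Y.measurable_past t
  have hf := Y.measurable_future t
  have hi := Y.measurable_internal t
  -- Under `P` restricted to one internal state, both sides are versions of the law of the future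
  -- given the past: `h1` by conditional independence, `h2` because the model generates from the
  -- full past.
  suffices h : ∀ s, ∀ᵐ ω ∂P, Y.internal t ω = s →
      condDistrib (Y.future t) (Y.past t) P (Y.past t ω) =
        Y.futureKernel P (Y.hidden t ω) by
    filter_upwards [ae_all_iff.2 h] with ω hω using hω _ rfl
  intro s
  have hs : MeasurableSet (Y.internal t ⁻¹' {s}) := hi (measurableSet_singleton s)
  have hz : Measurable fun y : PastList X => ((s, y 0) : HiddenState S X) := by fun_prop
  have h1 := condDistrib_ae_eq_of_forall_inter (P := P.restrict (Y.internal t ⁻¹' {s})) hp hf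
    (condDistrib (Y.future t) (Y.past t) P) fun A B hA hB => by
      have hw : Measurable fun y => condDistrib (Y.future t) (Y.past t) P y B :=
        (condDistrib (Y.future t) (Y.past t) P).measurable_coe hB
      have hw' : Measurable fun y => condDistrib (Y.internal t) (Y.past t) P y {s} :=
        (condDistrib (Y.internal t) (Y.past t) P).measurable_coe (measurableSet_singleton s)
      rw [Measure.restrict_apply ((hp hA).inter (hf hB)),
        ← setLIntegral_condDistrib_internal hstat hgen t s hA hB,
        setLIntegral_inter_condDistrib hp hf hA hB hw', Measure.restrict_restrict (hp hA),
        setLIntegral_inter_condDistrib hp hi hA (measurableSet_singleton s) hw]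
      simp only [mul_comm]
  have h2 := condDistrib_ae_eq_of_forall_inter (P := P.restrict (Y.internal t ⁻¹' {s})) hp hf
    ((Y.futureKernel P).comap _ hz) fun A B hA hB => by
      have hφ : Measurable fun q : ℕ → S × X × ℝ => ((fun k => (q k).2 : PastList X), (q 0).1) :=
        by fun_prop
      have hset : Y.past t ⁻¹' A ∩ Y.internal t ⁻¹' {s} = Y.fullPast t ⁻¹'
          ((fun q : ℕ → S × X × ℝ => ((fun k => (q k).2 : PastList X), (q 0).1)) ⁻¹'
            (A ×ˢ {s})) := by
        ext ω
        simp [fullPast, internal]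
      rw [Measure.restrict_apply ((hp hA).inter (hf hB)), Measure.restrict_restrict (hp hA),
        inter_right_comm, hset, measure_inter_future hstat hgen t
          (hφ (hA.prod (measurableSet_singleton s))) hB, ← hset]
      refine setLIntegral_congr_fun ((hp hA).inter hs) fun ω hω => ?_
      have : Y.internal t ω = s := hω.2
      simp only [Kernel.comap_apply]
      rw [← this, ← hidden_eq_internal]
  filter_upwards [(ae_restrict_iff' hs).1 h1, (ae_restrict_iff' hs).1 h2] with ω h1 h2 hω
  rw [← h1 hω, h2 hω, Kernel.comap_apply, ← hω, ← hidden_eq_internal]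

end EventSeq

end

/-! ### Laws of the future as states of a unifilar generator. -/

noncomputable section

namespace FutureList

variable {X : Type} [MeasurableSpace X]

open Classical in
/-- The kernel that sends a law of the future of mass at most `1` to itself. -/
def lawKernel (X : Type) [MeasurableSpace X] :
    Kernel (Measure (FutureList X)) (FutureList X) where
  toFun a := if a univ ≤ 1 then a else 0
  measurable' := Measurable.ite
    (measurableSet_le (Measure.measurable_coe .univ) measurable_const)
    measurable_id measurable_const

theorem lawKernel_apply (a : Measure (FutureList X)) [IsProbabilityMeasure a] :
    lawKernel X a = a := if_pos prob_le_one

/-- The cutoff in `lawKernel` serves this uniform bound, so that the kernel can be disintegrated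
jointly measurably in the law. -/
instance : IsFiniteKernel (lawKernel X) := ⟨1, ENNReal.one_lt_top, fun a => by
  show (if a univ ≤ 1 then a else 0 : Measure (FutureList X)) univ ≤ 1
  split_ifs with h
  · exact h
  · simp⟩

theorem measurable_observe_shift (s : ℝ) :
    Measurable fun F : FutureList X => (observe s F, shift s F) :=
  (measurable_observe s).prodMk (measurable_shift s)

variable [Countable X] [DiscreteMeasurableSpace X] [Nonempty X]

/-- The conditional law, under a law of the future, of what remains of the future after time `s`
given what is seen of it up to then. -/
def remainderKernel (X : Type) [MeasurableSpace X] [Countable X] [DiscreteMeasurableSpace X]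
    [Nonempty X] (s : ℝ) :
    Kernel (Measure (FutureList X) × (ℕ × (ℕ → X × ℝ))) (FutureList X) :=
  ((lawKernel X).map fun F => (observe s F, shift s F)).condKernel

instance (s : ℝ) : IsMarkovKernel (remainderKernel X s) := by
  unfold remainderKernel; infer_instance

theorem setLIntegral_remainderKernel (s : ℝ) (a : Measure (FutureList X))
    [IsProbabilityMeasure a] {A : Set (ℕ × (ℕ → X × ℝ))} (hA : MeasurableSet A)
    {B : Set (FutureList X)} (hB : MeasurableSet B) :
    ∫⁻ F in observe s ⁻¹' A, remainderKernel X s (a, observe s F) B ∂a =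
      a (observe s ⁻¹' A ∩ shift s ⁻¹' B) := by
  have hm := measurable_observe_shift (X := X) s
  let K := (lawKernel X).map fun F => (observe s F, shift s F)
  have h1 : K.fst a = a.map (observe s) := by
    simp only [K]
    rw [Kernel.fst_apply, Kernel.map_apply _ hm, lawKernel_apply,
      Measure.map_map measurable_fst hm]
    rfl
  have h2 : (K.fst ⊗ₖ K.condKernel) a (A ×ˢ B) = K a (A ×ˢ B) := by
    rw [K.disintegrate K.condKernel]
  have hw : Measurable fun b => remainderKernel X s (a, b) B :=
    ((remainderKernel X s).measurable_coe hB).comp measurable_prodMk_left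
  rw [Kernel.compProd_apply_prod hA hB, h1] at h2
  rw [← setLIntegral_map hA hw (measurable_observe s)]
  refine h2.trans ?_
  simp only [K]
  rw [Kernel.map_apply _ hm, lawKernel_apply, Measure.map_apply hm (hA.prod hB)]
  rfl

end FutureList

namespace EventSeq

open FutureList

variable {S X : Type} {Ω : Type*} [MeasurableSpace S] [MeasurableSpace X] [MeasurableSpace Ω]

open Classical in
/-- The observation that is determined by the symbols seen during a period of length `s`. -/
def observationOf [Nonempty X] (Y : EventSeq S X Ω) (s : ℝ) (p : Icc (0 : ℝ) s → X) :
    ℕ × (ℕ → X × ℝ) :=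
  if h : ∃ q : ℝ × Ω, (∀ n, Y.sym (n + 1) q.2 ≠ Y.sym n q.2) ∧
      ∀ r : Icc (0 : ℝ) s, Y.symbolAt (q.1 + r) q.2 = p r
  then observe s (Y.future h.choose.1 h.choose.2) else Classical.arbitrary _

theorem observationOf_symbolAt [Nonempty X] (Y : EventSeq S X Ω) {s : ℝ} (hs : 0 ≤ s) (t : ℝ)
    {ω : Ω} (hω : ∀ n, Y.sym (n + 1) ω ≠ Y.sym n ω) :
    Y.observationOf s (fun r => Y.symbolAt (t + r) ω) = observe s (Y.future t ω) := by
  have h : ∃ q : ℝ × Ω, (∀ n, Y.sym (n + 1) q.2 ≠ Y.sym n q.2) ∧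
      ∀ r : Icc (0 : ℝ) s, Y.symbolAt (q.1 + r) q.2 = Y.symbolAt (t + r) ω :=
    ⟨(t, ω), hω, fun _ => rfl⟩
  rw [observationOf, dif_pos h]
  exact Y.observe_eq_of_symbolAt_eq hs h.choose_spec.1 hω
    fun r hr => h.choose_spec.2 ⟨r, hr⟩

variable [Fintype X] [DiscreteMeasurableSpace X] [Nonempty X]

theorem history_futureKernel_le (Y : EventSeq S X Ω) (P : Measure Ω) [IsProbabilityMeasure P]
    (t : ℝ) : Y.history (fun t ω => Y.futureKernel P (Y.hidden t ω)) t ≤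
      MeasurableSpace.comap (Y.fullPast t) inferInstance := by
  have h0 := comap_measurable (m := MeasurableSpace.pi) (Y.fullPast t)
  refine sup_le (Y.measurable_past_of_fullPast h0).comap_le (iSup_le fun u => ?_)
  exact ((Y.futureKernel P).measurable.comp (Y.measurable_hidden_of_fullPast
    (Y.measurable_fullPast_of_le u.2 h0))).comap_le

variable [Countable S] [DiscreteMeasurableSpace S] {Y : EventSeq S X Ω} {P : Measure Ω} [IsProbabilityMeasure P]
  {M : UHSMM S X}

/-- Both sides are the law of the later future given the hidden state at `t` and the observation
since: `h1` by generation at `t + s`, `h2` by disintegrating the law at `t`. The right side sees the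
hidden state only through its law, which is unifilarity for laws. -/
theorem futureKernel_hidden_add (hstat : Y.IsStationary P) (hgen : Y.IsGeneratedBy P M) (t : ℝ)
    {s : ℝ} (hs : 0 ≤ s) :
    ∀ᵐ ω ∂P, Y.futureKernel P (Y.hidden (t + s) ω) =
      remainderKernel X s (Y.futureKernel P (Y.hidden t ω), observe s (Y.future t ω)) := by
  have hh := Y.measurable_hidden t
  have hf := Y.measurable_future t
  have hV : Measurable fun ω => (Y.hidden t ω, observe s (Y.future t ω)) :=
    hh.prodMk ((measurable_observe s).comp hf)
  have h1 := condDistrib_ae_eq_of_forall_inter (P := P) hV (Y.measurable_future (t + s))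
    ((Y.futureKernel P).comap _ (M.measurable_advance s)) fun A B hA hB => by
      have hm : Measurable[MeasurableSpace.comap (Y.fullPast (t + s)) inferInstance]
          fun ω => (Y.hidden t ω, observe s (Y.future t ω)) := by
        have h0 := comap_measurable (m := MeasurableSpace.pi) (Y.fullPast (t + s))
        exact (Y.measurable_hidden_of_fullPast
          (Y.measurable_fullPast_of_le (by linarith) h0)).prodMk
            (Y.measurable_observe_future hs (Y.measurable_past_of_fullPast h0))
      rw [measure_inter_future_of_comap hstat hgen (t + s) (hm hA) hB]
      simp only [Kernel.comap_apply, Y.hidden_add hgen.1 hs]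
  have hk : Measurable fun p : HiddenState S X × (ℕ × (ℕ → X × ℝ)) =>
      (Y.futureKernel P p.1, p.2) :=
    ((Y.futureKernel P).measurable.comp measurable_fst).prodMk measurable_snd
  have h2 := condDistrib_ae_eq_of_forall_inter (P := P) hV (Y.measurable_future (t + s))
    ((remainderKernel X s).comap _ hk) fun A B hA hB => by
      have hlaw : P.map (fun ω => (Y.hidden t ω, Y.future t ω)) =
          P.map (Y.hidden t) ⊗ₘ Y.futureKernel P := by
        rw [← condDistrib_future_hidden hstat t, compProd_map_condDistrib hf.aemeasurable]
      have hψ : Measurable fun p : HiddenState S X × FutureList X => (p.1, observe s p.2) :=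
        measurable_fst.prodMk ((measurable_observe s).comp measurable_snd)
      have hA' := hψ hA
      have hB' : MeasurableSet {p : HiddenState S X × FutureList X | shift s p.2 ∈ B} :=
        (measurable_shift s).comp measurable_snd hB
      have hw : Measurable fun p : HiddenState S X × FutureList X =>
          remainderKernel X s (Y.futureKernel P p.1, observe s p.2) B :=
        ((remainderKernel X s).measurable_coe hB).comp (hk.comp hψ)
      have hleft : P ((fun ω => (Y.hidden t ω, observe s (Y.future t ω))) ⁻¹' A ∩
          Y.future (t + s) ⁻¹' B) = P.map (fun ω => (Y.hidden t ω, Y.future t ω))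
            ((fun p : HiddenState S X × FutureList X => (p.1, observe s p.2)) ⁻¹' A ∩
              {p | shift s p.2 ∈ B}) := by
        rw [Measure.map_apply (hh.prodMk hf) (hA'.inter hB')]
        congr 1
        ext ω
        simp only [mem_inter_iff, mem_preimage, Y.shift_future hs]
        rfl
      have hright : ∫⁻ ω in (fun ω => (Y.hidden t ω, observe s (Y.future t ω))) ⁻¹' A,
          remainderKernel X s (Y.futureKernel P (Y.hidden t ω), observe s (Y.future t ω)) B ∂P =
          ∫⁻ p in (fun p : HiddenState S X × FutureList X => (p.1, observe s p.2)) ⁻¹' A,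
            remainderKernel X s (Y.futureKernel P p.1, observe s p.2) B
            ∂P.map (fun ω => (Y.hidden t ω, Y.future t ω)) := by
        rw [setLIntegral_map hA' hw (hh.prodMk hf)]
        rfl
      simp only [Kernel.comap_apply]
      rw [hleft, hright, hlaw, Measure.compProd_apply (hA'.inter hB'), ← lintegral_indicator hA',
        Measure.lintegral_compProd (hw.indicator hA')]
      refine lintegral_congr fun z => ?_
      have hAz : MeasurableSet (Prod.mk z ⁻¹' A) := measurable_prodMk_left hA
      refine (setLIntegral_remainderKernel s (Y.futureKernel P z) hAz hB).symm.trans ?_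
      rw [← lintegral_indicator (measurable_observe s hAz)]
      rfl
  filter_upwards [h1, h2] with ω h1 h2
  rw [h1, Kernel.comap_apply, Kernel.comap_apply, ← Y.hidden_add hgen.1 hs] at h2
  exact h2

/-- The laws of the future given the hidden state are the states of a unifilar generator. -/
theorem isUnifilarGenerator_futureKernel (hstat : Y.IsStationary P)
    (hgen : Y.IsGeneratedBy P M) :
    Y.IsUnifilarGenerator P (fun t ω => Y.futureKernel P (Y.hidden t ω)) where
  measurable t := (Y.futureKernel P).measurable.comp (Y.measurable_hidden t)
  generates := ⟨⟨id, measurable_id⟩, fun t E B hE hB =>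
    measure_inter_future_of_comap hstat hgen t (history_futureKernel_le Y P t E hE) hB⟩
  unifilar := ⟨fun s a p => remainderKernel X s (a, Y.observationOf s p), fun t s hs => by
    filter_upwards [futureKernel_hidden_add hstat hgen t hs, ae_sym_succ_ne hgen] with ω h1 h2
    rw [h1, Y.observationOf_symbolAt hs t h2]⟩

end EventSeq

end

/-! ### Measurable selection and the correspondence with causal states. -/

theorem measurableSet_kernel_eq {α β : Type*} [MeasurableSpace α] [MeasurableSpace β]
    [MeasurableSpace.CountablyGenerated β] (k k' : Kernel α β) [IsFiniteKernel k] :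
    MeasurableSet {a | k a = k' a} := by
  obtain ⟨b, hbc, hb⟩ :=
    (inferInstance : MeasurableSpace.CountablyGenerated β).isCountablyGenerated
  have h𝒜 := isSetAlgebra_generateSetAlgebra (𝒜 := b)
  have hgen : (inferInstance : MeasurableSpace β) =
      MeasurableSpace.generateFrom (generateSetAlgebra b) := by
    rw [generateFrom_generateSetAlgebra_eq]; exact hb
  have hc : (generateSetAlgebra b).Countable := countable_generateSetAlgebra hbc
  have : {a | k a = k' a} = ⋂ B ∈ generateSetAlgebra b, {a | k a B = k' a B} := by
    ext a
    simp only [mem_iInter]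
    refine ⟨fun h B _ => congrArg (fun μ : Measure β => μ B) h, fun h => ?_⟩
    exact ext_of_generate_finite _ hgen (fun s hs t ht _ => h𝒜.inter_mem hs ht) h
      (h _ h𝒜.univ_mem)
  rw [this]
  refine MeasurableSet.biInter hc fun B hB => ?_
  have hB' : MeasurableSet B := by
    have := MeasurableSpace.measurableSet_generateFrom hB
    rwa [← hgen] at this
  exact measurableSet_eq_fun (k.measurable_coe hB') (k'.measurable_coe hB')

/-- A measurable choice from finitely many sets. -/
theorem exists_measurable_mem {α ι : Type*} [MeasurableSpace α] [Finite ι] [Nonempty ι]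
    [MeasurableSpace ι] [DiscreteMeasurableSpace ι] {E : ι → Set α}
    (hE : ∀ i, MeasurableSet (E i)) :
    ∃ σ : α → ι, Measurable σ ∧ ∀ a ∈ ⋃ i, E i, a ∈ E (σ a) := by
  classical
  let T : (ι → Prop) → ι := fun p =>
    if h : ∃ i, p i then h.choose else Classical.arbitrary ι
  have hm : Measurable fun a i => a ∈ E i :=
    measurable_pi_lambda _ fun i => measurable_mem.2 (hE i)
  refine ⟨fun a => T fun i => a ∈ E i, (Measurable.of_discrete (f := T)).comp hm, fun a ha => ?_⟩
  have h : ∃ i, a ∈ E i := mem_iUnion.1 ha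
  simp only [T]
  rw [dif_pos h]
  exact h.choose_spec

theorem theorem2 {S X : Type} {Ω : Type*} [Fintype S] [Fintype X] [Nonempty X]
    [MeasurableSpace S] [DiscreteMeasurableSpace S]
    [MeasurableSpace X] [DiscreteMeasurableSpace X] [MeasurableSpace Ω]
    (P : Measure Ω) [IsProbabilityMeasure P]
    (M : UHSMM S X) (Y : EventSeq S X Ω)
    (hstat : Y.IsStationary P) (hgen : Y.IsGeneratedBy P M) (hmin : Y.HiddenIsMinimal P) :
    ∃ (h : PastList X → HiddenState S X) (A : Set (PastList X))
      (Ψ : HiddenState S X → Y.CausalState P),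
      Measurable h ∧ MeasurableSet A ∧ (∀ t, ∀ᵐ ω ∂P, Y.past t ω ∈ A) ∧
      -- the hidden state is almost surely determined by the past
      (∀ t, ∀ᵐ ω ∂P, Y.hidden t ω = h (Y.past t ω)) ∧
      -- the hidden state is a sufficient statistic of the past for the future
      (∀ t, ∀ᵐ ω ∂P, condDistrib (Y.future t) (Y.past t) P (Y.past t ω) =
        condDistrib (Y.future t) (Y.hidden t) P (Y.hidden t ω)) ∧
      -- pasts are in the same causal state if and only if they have the same hidden state
      (∀ y ∈ A, ∀ y' ∈ A, Y.causalState P y = Y.causalState P y' ↔ h y = h y') ∧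
      -- a one-to-one correspondence of hidden states with causal states, valid at all times
      BijOn Ψ (h '' A) (Y.causalState P '' A) ∧
      (∀ y ∈ A, Ψ (h y) = Y.causalState P y) ∧
      (∀ t, ∀ᵐ ω ∂P, Ψ (Y.hidden t ω) = Y.causalState P (Y.past t ω)) ∧
      -- the futures from a causal state are those which the model produces
      -- from the corresponding hidden state
      (∀ y ∈ A, ∀ Bs : List (Set (X × ℝ)), (∀ B ∈ Bs, MeasurableSet B) →
        Y.predictive P y (cylinderOf Bs) = M.futureProb (h y) Bs) := by
  classical
  have : Nonempty S := (nonempty_of_isProbabilityMeasure P).map (Y.internal 0)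
  -- The only use of minimality: on `D`, hidden states with the same law of the future coincide.
  obtain ⟨D, hD, hDae, hinj⟩ := hmin _ (fun z => Y.futureKernel P z)
    (Y.futureKernel P).measurable (EventSeq.isUnifilarGenerator_futureKernel hstat hgen)
  obtain ⟨G, hG, hGae, hGfut⟩ := EventSeq.exists_measurableSet_futureKernel_cylinderOf Y P M hstat hgen
  have hpred : ∀ t, ∀ᵐ ω ∂P, Y.predictive P (Y.past t ω) =
      Y.futureKernel P (Y.hidden t ω) := fun t => by
    have := EventSeq.condDistrib_past_eq_futureKernel hstat hgen t
    rwa [EventSeq.condDistrib_future_past hstat t] at this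
  -- Entry `0` of a past already shows the symbol and the age, so only the internal state must be
  -- found, among finitely many candidates.
  let E : S → Set (PastList X) := fun g =>
    {y | Y.predictive P y = Y.futureKernel P (g, y 0)} ∩ {y | (g, y 0) ∈ D ∩ G}
  have hz : ∀ g, Measurable fun y : PastList X => ((g, y 0) : HiddenState S X) :=
    fun g => by fun_prop
  have hE : ∀ g, MeasurableSet (E g) := fun g => by
    have h1 := measurableSet_kernel_eq (condDistrib (Y.future 0) (Y.past 0) P)
      ((Y.futureKernel P).comap _ (hz g))
    exact h1.inter (hz g (hD.inter hG))
  obtain ⟨σ, hσ, hσE⟩ := exists_measurable_mem hE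
  let h : PastList X → HiddenState S X := fun y => (σ y, y 0)
  have hA : ∀ y ∈ ⋃ g, E g, Y.predictive P y = Y.futureKernel P (h y) ∧ h y ∈ D ∧ h y ∈ G :=
    fun y hy => hσE y hy
  have hpastA : ∀ t, ∀ᵐ ω ∂P, Y.past t ω ∈ ⋃ g, E g := fun t => by
    filter_upwards [hpred t, hDae t, hGae t] with ω h1 h2 h3
    rw [EventSeq.hidden_eq_internal] at h1 h2 h3
    exact mem_iUnion.2 ⟨_, h1, h2, h3⟩
  have hhid : ∀ t, ∀ᵐ ω ∂P, Y.hidden t ω = h (Y.past t ω) := fun t => by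
    filter_upwards [hpred t, hDae t, hpastA t] with ω h1 h2 h3
    -- The true and the selected hidden state both lie in `D` and share the predictive law of the
    -- past.
    exact hinj h2 (hA _ h3).2.1 (h1.symm.trans (hA _ h3).1)
  have hiff : ∀ y ∈ ⋃ g, E g, ∀ y' ∈ ⋃ g, E g,
      Y.causalState P y = Y.causalState P y' ↔ h y = h y' := fun y hy y' hy' => by
    have hq : Y.causalState P y = Y.causalState P y' ↔
        Y.predictive P y = Y.predictive P y' := Quotient.eq
    rw [hq, (hA y hy).1, (hA y' hy').1]
    exact ⟨fun e => hinj (hA y hy).2.1 (hA y' hy').2.1 e, fun e => by rw [e]⟩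
  let Ψ : HiddenState S X → Y.CausalState P := fun z =>
    if hz : ∃ y ∈ ⋃ g, E g, h y = z then Y.causalState P hz.choose
    else Y.causalState P (Classical.arbitrary _)
  have hΨ : ∀ y ∈ ⋃ g, E g, Ψ (h y) = Y.causalState P y := fun y hy => by
    have hex : ∃ y' ∈ ⋃ g, E g, h y' = h y := ⟨y, hy, rfl⟩
    simp only [Ψ]
    rw [dif_pos hex]
    exact (hiff _ hex.choose_spec.1 _ hy).2 hex.choose_spec.2
  refine ⟨h, ⋃ g, E g, Ψ, hσ.prodMk (measurable_pi_apply 0), MeasurableSet.iUnion hE, hpastA,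
    hhid, fun t => ?_, hiff, ⟨?_, ?_, ?_⟩, hΨ, fun t => ?_, fun y hy Bs hBs => ?_⟩
  · rw [EventSeq.condDistrib_future_hidden hstat t]
    exact EventSeq.condDistrib_past_eq_futureKernel hstat hgen t
  · rintro _ ⟨y, hy, rfl⟩
    exact ⟨y, hy, (hΨ y hy).symm⟩
  · rintro _ ⟨y, hy, rfl⟩ _ ⟨y', hy', rfl⟩ e
    rw [hΨ y hy, hΨ y' hy'] at e
    exact (hiff y hy y' hy').1 e
  · rintro _ ⟨y, hy, rfl⟩
    exact ⟨h y, ⟨y, hy, rfl⟩, hΨ y hy⟩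
  · filter_upwards [hhid t, hpastA t] with ω h1 h2
    rw [h1, hΨ _ h2]
  · rw [(hA y hy).1]
    exact hGfut _ (hA y hy).2.2 Bs hBs
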